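/- **Setting.** Let $\mathcal G$ be a fixed undirected weighted graph on the sensors $\{1,\dots,n\}$ with weighted adjacency matrix $\mathcal A=[a_{ij}]$: $a_{ij}=a_{ji}\ge 0$, $\sum_j a_{ij}=1$, $a_{ii}>0$, and $i,j$ are neighbours iff $a_{ij}>0$; $\mathcal N_i=\{j: a_{ji}>0\}$ (so $i\in\mathcal N_i$). Assume $\mathcal G$ is connected, let $D_{\mathcal G}$ be its diameter, and let $a_{\min}=\min_{i,j}a^{(D_{\mathcal G})}_{ij}$, where $a^{(k)}_{ij}$ are the entries of $\mathcal A^k$. Let $(\Omega,\mathscr F,\mathbb P)$ be a probability space with a non-decreasing sequence of $\sigma$-algebras $\{\mathscr F_t\}_{t\ge0}$, and let $\varphi_{t,i}\in\mathbb R^m$ ($t\ge 0$, $1\le i\le n$) be random vectors adapted to $\{\mathscr F_t\}$, and $y_{t,i}$ real measurements. For a random matrix or vector $X$ put $\|X\|_{L_p}=(\mathbb E\|X\|^p)^{1/p}$, where $\|\cdot\|$ is the Euclidean (spectral) norm. **Algorithm.** Given a forgetting factor $\alpha$, initial vectors $\hat\theta_{0,i}\in\mathbb R^m$ and initial positive definite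 matrices $P_{0,i}\in\mathbb R^{m\times m}$, the diffusion forgetting factor least squares (FFLS) algorithm is, for $t\ge0$ and $1\le i\le n$, $$\bar\theta_{t+1,i}=\hat\theta_{t,i}+\frac{P_{t,i}\varphi_{t,i}}{\alpha+\varphi_{t,i}^TP_{t,i}\varphi_{t,i}}\,(y_{t+1,i}-\varphi_{t,i}^T\hat\theta_{t,i}),\qquad \bar P_{t+1,i}=\frac1\alpha\Big(P_{t,i}-\frac{P_{t,i}\varphi_{t,i}\varphi_{t,i}^TP_{t,i}}{\alpha+\varphi_{t,i}^TP_{t,i}\varphi_{t,i}}\Big),$$ $$P_{t+1,i}^{-1}=\sum_{j\in\mathcal N_i}a_{ij}\bar P_{t+1,j}^{-1},\qquad \hat\theta_{t+1,i}=P_{t+1,i}\sum_{j\in\mathcal N_i}a_{ij}\bar P_{t+1,j}^{-1}\bar\theta_{t+1,j}.$$ Put $P_t=\mathrm{diag}\{P_{t,1},\dots,P_{t,n}\}$ (an $mn\times mn$ block diagonal matrix) and $\mathscr A=\mathcal A\otimes I_m$. **Cooperative excitation condition.** There are an integer $h>0$ and $\lambda\in(0,1)$ such that, with $$\lambda_t=\lambda_{\min}\left[\mathbb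 E\left(\frac1{n(1+h)}\sum_{i=1}^n\sum_{k=th+1}^{(t+1)h}\frac{\varphi_{k,i}\varphi_{k,i}^T}{1+\|\varphi_{k,i}\|^2}\,\Big|\,\mathscr F_{th}\right)\right],$$ one has $1-\lambda_t\in[0,1)$ almost surely for every $t\ge0$, and there is $M>0$ with $\mathbb E\prod_{j=k+1}^t(1-\lambda_j)\le M\lambda^{t-k}$ for all $t\ge k\ge0$. **Theorem.** Let $p\ge1$. Assume the cooperative excitation condition with $h$ and $\lambda$, assume $\sup_t\|\varphi_{t,i}\|_{L_{6p}}<\infty$ for every $i$, and $$\lambda^{\frac{a_{\min}^2}{32pmh(4h+D_{\mathcal G}-1)}}<\alpha<1 .$$ Then the random matrix sequence $A_t=\alpha P_{t+1}\mathscr A P_t^{-1}$, $t\ge0$, is $L_p$-exponentially stable: there are $\gamma\in[0,1)$ and $M>0$ such that $$\big\|A_tA_{t-1}\cdots A_{k+1}\big\|_{L_p}\le M\gamma^{\,t-k}\qquad\text{for all } t\ge k\ge0,$$ where the empty product ($t=k$) is the identity. -/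

import Mathlib

open MeasureTheory
open scoped Matrix Kronecker ENNReal Matrix.Norms.L2Operator

noncomputable section

namespace DiffusionFFLS

/-- A fixed undirected weighted communication graph on `n` sensors. The edges are the pairs of
positive weight, every sensor is its own neighbour, and the weight matrix is stochastic. -/
structure SensorNetwork (n : ℕ) where
  /-- the weighted adjacency matrix -/
  weight : Matrix (Fin n) (Fin n) ℝ
  weight_nonneg : ∀ i j, 0 ≤ weight i j
  weight_symm : ∀ i j, weight i j = weight j i
  weight_self_pos : ∀ i, 0 < weight i i
  weight_row_sum : ∀ i, ∑ j, weight i j = 1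

namespace SensorNetwork

variable {n : ℕ}

/-- The underlying simple graph (edges between distinct sensors). -/
def graph (G : SensorNetwork n) : SimpleGraph (Fin n) where
  Adj i j := i ≠ j ∧ 0 < G.weight i j
  symm := ⟨fun i j h => ⟨h.1.symm, by rw [G.weight_symm]; exact h.2⟩⟩
  loopless := ⟨fun _ h => h.1 rfl⟩

/-- The neighbour set of the sensor `i`; it contains `i`. -/
def neighbors (G : SensorNetwork n) (i : Fin n) : Finset (Fin n) :=
  Finset.univ.filter fun j => 0 < G.weight j i

/-- The diameter of the graph. -/
def diameter (G : SensorNetwork n) : ℕ := G.graph.diam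

/-- The smallest entry of the power of the weight matrix whose exponent is the diameter. -/
def aMin (G : SensorNetwork n) : ℝ :=
  ⨅ ij : Fin n × Fin n, (G.weight ^ G.diameter) ij.1 ij.2

end SensorNetwork

/-- The state of the distributed algorithm: at each sensor, the parameter estimate and the
gain matrix. -/
structure State (n m : ℕ) where
  est : Fin n → Fin m → ℝ
  P : Fin n → Matrix (Fin m) (Fin m) ℝ

section Algorithm

variable {n m : ℕ}

/-- Adaption step: the intermediate estimate at one sensor. -/
def adaptEst (α : ℝ) (θ : Fin m → ℝ) (P : Matrix (Fin m) (Fin m) ℝ) (φ : Fin m → ℝ) (y : ℝ) :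
    Fin m → ℝ :=
  θ + ((y - φ ⬝ᵥ θ) / (α + φ ⬝ᵥ (P *ᵥ φ))) • (P *ᵥ φ)

/-- Adaption step: the intermediate gain matrix at one sensor. -/
def adaptP (α : ℝ) (P : Matrix (Fin m) (Fin m) ℝ) (φ : Fin m → ℝ) : Matrix (Fin m) (Fin m) ℝ :=
  (1 / α) • (P - (1 / (α + φ ⬝ᵥ (P *ᵥ φ))) • (P * Matrix.vecMulVec φ φ * P))

/-- Combination step: the new gain matrix of the sensor `i`, defined through its inverse. -/
def combineP (G : SensorNetwork n) (Pbar : Fin n → Matrix (Fin m) (Fin m) ℝ) (i : Fin n) :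
    Matrix (Fin m) (Fin m) ℝ :=
  (∑ j ∈ G.neighbors i, G.weight i j • (Pbar j)⁻¹)⁻¹

/-- One round (adaption at every sensor, then combination at every sensor), with regressors
`φ j` and measurements `y j`. -/
def step (G : SensorNetwork n) (α : ℝ) (φ : Fin n → Fin m → ℝ) (y : Fin n → ℝ)
    (s : State n m) : State n m where
  est i :=
    combineP G (fun j => adaptP α (s.P j) (φ j)) i *ᵥ
      ∑ j ∈ G.neighbors i, G.weight i j •
        ((adaptP α (s.P j) (φ j))⁻¹ *ᵥ adaptEst α (s.est j) (s.P j) (φ j) (y j))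
  P i := combineP G (fun j => adaptP α (s.P j) (φ j)) i

/-- The distributed (diffusion) forgetting factor least squares algorithm, run on one realization
of the regressors `φ t i` and of the measurements `y t i`. -/
def ffls (G : SensorNetwork n) (α : ℝ) (φ : ℕ → Fin n → Fin m → ℝ) (y : ℕ → Fin n → ℝ)
    (θ₀ : Fin n → Fin m → ℝ) (P₀ : Fin n → Matrix (Fin m) (Fin m) ℝ) : ℕ → State n m
  | 0 => ⟨θ₀, P₀⟩
  | t + 1 => step G α (φ t) (y (t + 1)) (ffls G α φ y θ₀ P₀ t)

/-- The block diagonal matrix `diag{P 1, …, P n}`, with rows and columns indexed by pairs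
(block, position inside the block). -/
def blockDiag (P : Fin n → Matrix (Fin m) (Fin m) ℝ) :
    Matrix (Fin n × Fin m) (Fin n × Fin m) ℝ :=
  Matrix.reindex (Equiv.prodComm _ _) (Equiv.prodComm _ _) (Matrix.blockDiagonal P)

/-- The matrix `α P_{t+1} (A ⊗ I_m) P_t⁻¹` of the homogeneous part of the error equation. -/
def errorMatrix (G : SensorNetwork n) (α : ℝ) (φ : ℕ → Fin n → Fin m → ℝ) (y : ℕ → Fin n → ℝ)
    (θ₀ : Fin n → Fin m → ℝ) (P₀ : Fin n → Matrix (Fin m) (Fin m) ℝ) (t : ℕ) :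
    Matrix (Fin n × Fin m) (Fin n × Fin m) ℝ :=
  α • (blockDiag (ffls G α φ y θ₀ P₀ (t + 1)).P *
    (G.weight ⊗ₖ (1 : Matrix (Fin m) (Fin m) ℝ)) *
    (blockDiag (ffls G α φ y θ₀ P₀ t).P)⁻¹)

end Algorithm

section Stability

variable {Ω : Type*} [MeasurableSpace Ω]

/-- The class `S⁰(lam)` of scalar random sequences. -/
def S0 (μ : Measure Ω) (lam : ℝ) (a : ℕ → Ω → ℝ) : Prop :=
  (∀ t, AEMeasurable (a t) μ) ∧
  (∀ t, ∀ᵐ ω ∂μ, a t ω ∈ Set.Ico (0 : ℝ) 1) ∧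
  ∃ M : ℝ, 0 < M ∧ ∀ k t : ℕ, k ≤ t →
    ∫ ω, ∏ j ∈ Finset.Ioc k t, a j ω ∂μ ≤ M * lam ^ (t - k)

/-- `orderedProd A k d` is the product `A (k + d) * ⋯ * A (k + 2) * A (k + 1)`. -/
def orderedProd {ι : Type*} [Fintype ι] [DecidableEq ι] (A : ℕ → Matrix ι ι ℝ) (k : ℕ) :
    ℕ → Matrix ι ι ℝ
  | 0 => 1
  | d + 1 => A (k + d + 1) * orderedProd A k d

/-- `A` is `L_p`-exponentially stable with parameter `lam`, that is, it belongs to `S_p(lam)`.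
The matrix norm is the spectral norm; the `L_p`-norm takes values in `[0, ∞]`. -/
def MemSp (μ : Measure Ω) {ι : Type*} [Fintype ι] [DecidableEq ι] (p lam : ℝ)
    (A : ℕ → Ω → Matrix ι ι ℝ) : Prop :=
  (∀ t i j, AEMeasurable (fun ω => A t ω i j) μ) ∧
  ∃ M : ℝ, 0 < M ∧ ∀ k t : ℕ, k ≤ t →
    eLpNorm (fun ω => orderedProd (fun s => A s ω) k (t - k)) (ENNReal.ofReal p) μ
      ≤ ENNReal.ofReal (M * lam ^ (t - k))

/-- `L_p`-exponential stability of a sequence of random matrices. -/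
def LpExponentiallyStable (μ : Measure Ω) {ι : Type*} [Fintype ι] [DecidableEq ι] (p : ℝ)
    (A : ℕ → Ω → Matrix ι ι ℝ) : Prop :=
  ∃ lam : ℝ, 0 ≤ lam ∧ lam < 1 ∧ MemSp μ p lam A

end Stability

section Excitation

variable {Ω : Type*} [mΩ : MeasurableSpace Ω] {n m : ℕ}

/-- The smallest eigenvalue of a real symmetric matrix. -/
def minEigenvalue (B : Matrix (Fin m) (Fin m) ℝ) : ℝ := sInf (spectrum ℝ B)

/-- The averaged normalized information matrix of all sensors over the times
`t * h + 1, …, (t + 1) * h`. -/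
def windowInfo (φ : ℕ → Fin n → Ω → EuclideanSpace ℝ (Fin m)) (h t : ℕ) (ω : Ω) :
    Matrix (Fin m) (Fin m) ℝ :=
  (1 / ((n : ℝ) * (1 + (h : ℝ)))) • ∑ i, ∑ k ∈ Finset.Icc (t * h + 1) ((t + 1) * h),
    (1 / (1 + ‖φ k i ω‖ ^ 2)) • Matrix.vecMulVec (φ k i ω).ofLp (φ k i ω).ofLp

/-- The smallest eigenvalue of the conditional expectation (taken entrywise) of the information
matrix of the `t`-th window, given the past of that window. -/
def excitation (μ : Measure Ω) (ℱ : Filtration ℕ mΩ)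
    (φ : ℕ → Fin n → Ω → EuclideanSpace ℝ (Fin m)) (h t : ℕ) (ω : Ω) : ℝ :=
  minEigenvalue (Matrix.of fun a b => (μ[fun ω' => windowInfo φ h t ω' a b | ℱ (t * h)]) ω)

/-- The cooperative excitation condition with window length `h` and rate `lam`. -/
def CooperativeExcitation (μ : Measure Ω) (ℱ : Filtration ℕ mΩ)
    (φ : ℕ → Fin n → Ω → EuclideanSpace ℝ (Fin m)) (h : ℕ) (lam : ℝ) : Prop :=
  (∀ i, StronglyAdapted ℱ fun t => φ t i) ∧ 0 < h ∧ 0 < lam ∧ lam < 1 ∧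
    S0 μ lam fun t ω => 1 - excitation μ ℱ φ h t ω

end Excitation

end DiffusionFFLS

end

noncomputable section

namespace DiffusionFFLS

/-! ### Quadratic forms, traces and inverses of positive semidefinite matrices. -/

section QuadraticForms

variable {ι : Type*} [Fintype ι]

/-! The inverses R_t of the gain matrices (`info`) obey a linear recursion: add φφᵀ to αR_t, then
average over the neighbours. The product of the A's therefore telescopes to α^d R_{k+d+1}⁻¹ (𝒜 ⊗
I)^d R_{k+1} with d = t - k (`orderedProd_errorMatrix`). Averaging does not increase the spectral
norm, so the rate is α itself, and by Hölder it remains to bound tr R_t and ‖R_t⁻¹‖ in L_{2p},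
uniformly in t.

The total trace of R_t is multiplied by α and receives Σ‖φ‖² at each step, so α < 1 and the moments
of φ bound it (`exists_eLpNorm_sum_trace_info_le`).

For the inverse, after at least D_𝒢 averagings each regressor has reached every sensor with weight
at least a_min. Hence R_t dominates a fixed multiple of S_q, where S_{j+1} = β(S_j + B_j), S_0 = 1,
β = α^h, B_j is the information of the j-th window, and q counts the windows old enough
(`exists_accum_le_info`). The trace y_j of S_j⁻¹ satisfies y_{j+1} ≤ β⁻¹(u_j y_j + 1), where u_j ∈
[1/2, 1] is affine in B_j with coefficients known from the past (`contraction`). Its conditional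
mean is thus the same expression at the conditional mean of B_j, at most 1 - λ_j/(2m) ≤ (1 - λ_j)^κ
with κ = 1/(2m(1+h)) (`condExp_contraction_le`).

Excitation controls products of 1 - λ_j, not products of the u_j. With v_j the conditional mean of
u_j, the product of the u_j/v_j has mean one, and Cauchy-Schwarz gives E√∏u ≤ √(E∏v)
(`integral_sqrt_prod_le`). Since u_j ≤ 1, this bounds the L_q norm of ∏u by a constant times
λ^{κ(t-k)/(2q)} (`eLpNorm_prod_le`). At q = 2p the lower bound on α makes this decay beat the growth
β^{-(t-k)}, and the unrolled recursion is summed as a geometric series. -/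

theorem dotProduct_mulVec_vecMulVec_self (v x : ι → ℝ) :
    x ⬝ᵥ (Matrix.vecMulVec v v *ᵥ x) = (v ⬝ᵥ x) ^ 2 := by
  rw [Matrix.vecMulVec_mulVec]
  simp [dotProduct_smul, dotProduct_comm x v, sq]

theorem dotProduct_mulVec_comm {A : Matrix ι ι ℝ} (hA : A.IsHermitian) (x y : ι → ℝ) :
    x ⬝ᵥ (A *ᵥ y) = y ⬝ᵥ (A *ᵥ x) := by
  have hT : Aᵀ = A := by simpa using! hA.eq
  rw [Matrix.dotProduct_mulVec, ← Matrix.mulVec_transpose, hT, dotProduct_comm]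

theorem posSemidef_quadForm_nonneg {A : Matrix ι ι ℝ} (hA : A.PosSemidef) (x : ι → ℝ) :
    0 ≤ x ⬝ᵥ (A *ᵥ x) := by
  simpa using hA.dotProduct_mulVec_nonneg x

theorem dotProduct_self_nonneg' (x : ι → ℝ) : 0 ≤ x ⬝ᵥ x :=
  Finset.sum_nonneg fun i _ => mul_self_nonneg (x i)

/-- The Cauchy-Schwarz inequality for the form of a positive semidefinite matrix. -/
theorem posSemidef_sq_le {A : Matrix ι ι ℝ} (hA : A.PosSemidef) (x y : ι → ℝ) :
    (x ⬝ᵥ (A *ᵥ y)) ^ 2 ≤ (x ⬝ᵥ (A *ᵥ x)) * (y ⬝ᵥ (A *ᵥ y)) := by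
  have key : ∀ t : ℝ, 0 ≤ (y ⬝ᵥ (A *ᵥ y)) * (t * t) + (2 * (x ⬝ᵥ (A *ᵥ y))) * t
      + x ⬝ᵥ (A *ᵥ x) := by
    intro t
    have h := posSemidef_quadForm_nonneg hA (x + t • y)
    rw [Matrix.mulVec_add, add_dotProduct, dotProduct_add, dotProduct_add, Matrix.mulVec_smul,
      dotProduct_smul, smul_dotProduct, smul_dotProduct, dotProduct_smul,
      dotProduct_mulVec_comm hA.isHermitian y x] at h
    simp only [smul_eq_mul] at h
    linarith
  have := discrim_le_zero key
  rw [discrim] at this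
  linarith

theorem quadForm_le_trace {A : Matrix ι ι ℝ} (hA : A.PosSemidef) (x : ι → ℝ) :
    x ⬝ᵥ (A *ᵥ x) ≤ A.trace * (x ⬝ᵥ x) := by
  obtain ⟨k, v, rfl⟩ := Matrix.posSemidef_iff_eq_sum_vecMulVec.mp hA
  rw [Matrix.sum_mulVec, dotProduct_sum, Matrix.trace_sum, Finset.sum_mul]
  refine Finset.sum_le_sum fun i _ => ?_
  rw [star_trivial, dotProduct_mulVec_vecMulVec_self, Matrix.trace_vecMulVec]
  simpa only [dotProduct, ← sq] using Finset.sum_mul_sq_le_sq_mul_sq Finset.univ (v i) x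

theorem norm_toLp_sq (x : ι → ℝ) : ‖(WithLp.toLp 2 x : EuclideanSpace ℝ ι)‖ ^ 2 = x ⬝ᵥ x := by
  rw [EuclideanSpace.real_norm_sq_eq]
  simp [dotProduct, sq]

theorem trace_sq_le_card_mul_sum_sq (Q : Matrix ι ι ℝ) :
    Q.trace ^ 2 ≤ Fintype.card ι * ∑ c, (Q c) ⬝ᵥ (Q c) := by
  have h := sq_sum_le_card_mul_sum_sq (s := Finset.univ) (f := fun c => Q c c)
  refine h.trans ?_
  rw [Finset.card_univ]
  gcongr with c
  rw [sq]
  exact Finset.single_le_sum (f := fun a => Q c a * Q c a) (fun a _ => mul_self_nonneg _)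
    (Finset.mem_univ c)

variable [DecidableEq ι]

theorem l2_opNorm_le_of_quadForm {A : Matrix ι ι ℝ} {c : ℝ} (hc : 0 ≤ c)
    (h : ∀ x : ι → ℝ, (A *ᵥ x) ⬝ᵥ (A *ᵥ x) ≤ c ^ 2 * (x ⬝ᵥ x)) : ‖A‖ ≤ c := by
  rw [← Matrix.l2_opNorm_toEuclideanCLM]
  refine ContinuousLinearMap.opNorm_le_bound _ hc fun x => ?_
  refine le_of_sq_le_sq ?_ (by positivity)
  rw [mul_pow]
  have h1 := h x.ofLp
  rw [← norm_toLp_sq, ← norm_toLp_sq] at h1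
  exact h1

theorem l2_opNorm_le_trace {A : Matrix ι ι ℝ} (hA : A.PosSemidef) : ‖A‖ ≤ A.trace := by
  refine l2_opNorm_le_of_quadForm hA.trace_nonneg fun x => ?_
  have h1 := posSemidef_sq_le hA (A *ᵥ x) x
  have h2 := quadForm_le_trace hA x
  have h3 := quadForm_le_trace hA (A *ᵥ x)
  have h4 := dotProduct_self_nonneg' (A *ᵥ x)
  have h5 := posSemidef_quadForm_nonneg hA x
  have h6 := hA.trace_nonneg
  rcases h4.eq_or_lt with h0 | h0
  · rw [← h0]
    exact mul_nonneg (sq_nonneg _) (dotProduct_self_nonneg' x)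
  · have : ((A *ᵥ x) ⬝ᵥ (A *ᵥ x)) ^ 2
        ≤ (A.trace * ((A *ᵥ x) ⬝ᵥ (A *ᵥ x))) * (A.trace * (x ⬝ᵥ x)) :=
      h1.trans (mul_le_mul h3 h2 h5 (by positivity))
    have h7 : ((A *ᵥ x) ⬝ᵥ (A *ᵥ x)) * ((A *ᵥ x) ⬝ᵥ (A *ᵥ x))
      ≤ (A.trace ^ 2 * (x ⬝ᵥ x)) * ((A *ᵥ x) ⬝ᵥ (A *ᵥ x)) := by nlinarith
    exact le_of_mul_le_mul_right h7 h0

/-- A quadratic form bounded below by `c` has an inverse of norm at most `1 / c`. -/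
theorem l2_opNorm_inv_le {A : Matrix ι ι ℝ} {c : ℝ} (hc : 0 < c)
    (hA : IsUnit A.det) (h : ∀ x : ι → ℝ, c * (x ⬝ᵥ x) ≤ x ⬝ᵥ (A *ᵥ x)) : ‖A⁻¹‖ ≤ c⁻¹ := by
  refine l2_opNorm_le_of_quadForm (inv_nonneg.2 hc.le) fun z => ?_
  set x := A⁻¹ *ᵥ z with hx
  have hz : A *ᵥ x = z := by rw [hx, Matrix.mulVec_mulVec, Matrix.mul_nonsing_inv _ hA,
    Matrix.one_mulVec]
  have h1 := h x
  rw [hz] at h1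
  have h2 : (x ⬝ᵥ z) ^ 2 ≤ (x ⬝ᵥ x) * (z ⬝ᵥ z) := by
    simpa only [dotProduct, ← sq] using Finset.sum_mul_sq_le_sq_mul_sq Finset.univ x z
  have h3 := dotProduct_self_nonneg' x
  rcases h3.eq_or_lt with h0 | h0
  · rw [← h0]
    exact mul_nonneg (sq_nonneg _) (dotProduct_self_nonneg' z)
  · have h4 : (c * (x ⬝ᵥ x)) ^ 2 ≤ (x ⬝ᵥ x) * (z ⬝ᵥ z) :=
      (pow_le_pow_left₀ (by positivity) h1 2).trans h2
    have h5 : c ^ 2 * (x ⬝ᵥ x) ≤ z ⬝ᵥ z := by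
      refine le_of_mul_le_mul_right ?_ h0
      nlinarith
    rw [inv_pow, inv_mul_eq_div, le_div_iff₀ (by positivity)]
    linarith

theorem dotProduct_self_le_trace_inv_mul {S : Matrix ι ι ℝ} (hS : S.PosDef) (x : ι → ℝ) :
    x ⬝ᵥ x ≤ S⁻¹.trace * (x ⬝ᵥ (S *ᵥ x)) := by
  have hu : IsUnit S.det := (Matrix.isUnit_iff_isUnit_det S).1 hS.isUnit
  have hx : S⁻¹ *ᵥ (S *ᵥ x) = x := by
    rw [Matrix.mulVec_mulVec, Matrix.nonsing_inv_mul _ hu, Matrix.one_mulVec]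
  have h1 := posSemidef_sq_le hS.inv.posSemidef x (S *ᵥ x)
  have h2 := quadForm_le_trace hS.inv.posSemidef x
  rw [hx, dotProduct_comm (S *ᵥ x) x] at h1
  have h3 := posSemidef_quadForm_nonneg hS.posSemidef x
  rcases (dotProduct_self_nonneg' x).eq_or_lt with h0 | h0
  · rw [← h0]
    exact mul_nonneg hS.inv.posSemidef.trace_nonneg h3
  · refine le_of_mul_le_mul_right ?_ h0
    nlinarith [mul_le_mul_of_nonneg_right h2 h3]

/-- Adding a positive semidefinite `B ≤ 1` to a positive definite matrix lowers the form of the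
inverse by a definite amount. -/
theorem quadForm_inv_add_le {S B : Matrix ι ι ℝ} (hS : S.PosDef) (hB : B.PosSemidef)
    (hB1 : ∀ x : ι → ℝ, x ⬝ᵥ (B *ᵥ x) ≤ x ⬝ᵥ x) (v : ι → ℝ) :
    v ⬝ᵥ ((S + B)⁻¹ *ᵥ v) + (S⁻¹ *ᵥ v) ⬝ᵥ (B *ᵥ (S⁻¹ *ᵥ v)) / (1 + S⁻¹.trace)
      ≤ v ⬝ᵥ (S⁻¹ *ᵥ v) := by
  have hSu : IsUnit S.det := (Matrix.isUnit_iff_isUnit_det S).1 hS.isUnit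
  have hT := hS.add_posSemidef hB
  have hTu : IsUnit (S + B).det := (Matrix.isUnit_iff_isUnit_det _).1 hT.isUnit
  have hy := hS.inv.posSemidef.trace_nonneg
  set y := S⁻¹.trace with hydef
  -- With these u and w, S⁻¹v = u + w, and the drop of the form equals uᵀBu + wᵀBu. Both wᵀBw ≤ y
  -- wᵀBu and wᵀBu ≤ y uᵀBu hold, so the form of B at u + w is at most (1 + y) times this drop.
  set u := (S + B)⁻¹ *ᵥ v with hu
  set w := S⁻¹ *ᵥ (B *ᵥ u) with hw
  have hv : v = S *ᵥ u + B *ᵥ u := by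
    rw [← Matrix.add_mulVec, hu, Matrix.mulVec_mulVec, Matrix.mul_nonsing_inv _ hTu,
      Matrix.one_mulVec]
  have hSw : S *ᵥ w = B *ᵥ u := by
    rw [hw, Matrix.mulVec_mulVec, Matrix.mul_nonsing_inv _ hSu, Matrix.one_mulVec]
  have hs : S⁻¹ *ᵥ v = u + w := by
    rw [hv, Matrix.mulVec_add, Matrix.mulVec_mulVec _ _ S, Matrix.nonsing_inv_mul _ hSu,
      Matrix.one_mulVec]
  rw [hs]
  have hN : w ⬝ᵥ (B *ᵥ u) = w ⬝ᵥ (S *ᵥ w) := by rw [hSw]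
  have hN0 : 0 ≤ w ⬝ᵥ (B *ᵥ u) := hN ▸ posSemidef_quadForm_nonneg hS.posSemidef w
  have hcs := posSemidef_sq_le hB w u
  have hw1 : w ⬝ᵥ (B *ᵥ w) ≤ y * (w ⬝ᵥ (B *ᵥ u)) := by
    rw [hN]
    exact (hB1 w).trans (dotProduct_self_le_trace_inv_mul hS w)
  have hqu := posSemidef_quadForm_nonneg hB u
  have hN1 : w ⬝ᵥ (B *ᵥ u) ≤ y * (u ⬝ᵥ (B *ᵥ u)) := by
    rcases hN0.eq_or_lt with h0 | h0
    · rw [← h0]; positivity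
    · refine le_of_mul_le_mul_right ?_ h0
      nlinarith [mul_le_mul_of_nonneg_right hw1 hqu]
  have e1 : v ⬝ᵥ (u + w) = v ⬝ᵥ u + (u ⬝ᵥ (B *ᵥ u) + w ⬝ᵥ (B *ᵥ u)) := by
    rw [dotProduct_add]
    congr 1
    rw [dotProduct_comm, hv, dotProduct_add, dotProduct_mulVec_comm hS.isHermitian w u, hSw]
  have e2 : (u + w) ⬝ᵥ (B *ᵥ (u + w))
      = u ⬝ᵥ (B *ᵥ u) + 2 * (w ⬝ᵥ (B *ᵥ u)) + w ⬝ᵥ (B *ᵥ w) := by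
    rw [Matrix.mulVec_add, add_dotProduct, dotProduct_add, dotProduct_add,
      dotProduct_mulVec_comm hB.isHermitian u w]
    ring
  rw [e1, e2]
  have : (u ⬝ᵥ (B *ᵥ u) + 2 * (w ⬝ᵥ (B *ᵥ u)) + w ⬝ᵥ (B *ᵥ w)) / (1 + y)
      ≤ u ⬝ᵥ (B *ᵥ u) + w ⬝ᵥ (B *ᵥ u) := by
    rw [div_le_iff₀ (by positivity)]
    nlinarith
  linarith

theorem single_quadForm (A : Matrix ι ι ℝ) (c : ι) :
    Pi.single c 1 ⬝ᵥ (A *ᵥ Pi.single c 1) = A c c := by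
  simp

/-- Sum `quadForm_inv_add_le` over the standard basis; by symmetry the columns of S⁻¹ are its rows.
-/
theorem trace_inv_add_le {S B : Matrix ι ι ℝ} (hS : S.PosDef) (hB : B.PosSemidef)
    (hB1 : ∀ x : ι → ℝ, x ⬝ᵥ (B *ᵥ x) ≤ x ⬝ᵥ x) :
    (S + B)⁻¹.trace + (∑ c, (S⁻¹ c) ⬝ᵥ (B *ᵥ (S⁻¹ c))) / (1 + S⁻¹.trace) ≤ S⁻¹.trace := by
  rw [Finset.sum_div]
  conv_lhs => enter [1]; rw [Matrix.trace]
  conv_rhs => rw [Matrix.trace]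
  rw [← Finset.sum_add_distrib]
  refine Finset.sum_le_sum fun c _ => ?_
  have h := quadForm_inv_add_le hS hB hB1 (Pi.single c 1)
  have hc : S⁻¹ *ᵥ Pi.single c 1 = S⁻¹ c := by
    ext a
    simp only [Matrix.mulVec_single_one, Matrix.col_apply]
    simpa using hS.inv.isHermitian.apply c a
  rw [single_quadForm, single_quadForm, hc] at h
  exact h

/-- Cauchy-Schwarz in the form of Q bounds the square of the c-th row by tr Q · Q_cc; then sum over
c. -/
theorem sum_sq_le_trace_sq {Q : Matrix ι ι ℝ} (hQ : Q.PosSemidef) :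
    ∑ c, (Q c) ⬝ᵥ (Q c) ≤ Q.trace ^ 2 := by
  rw [sq]
  nth_rewrite 2 [Matrix.trace]
  rw [Finset.mul_sum]
  refine Finset.sum_le_sum fun c _ => ?_
  have hc : Q *ᵥ Pi.single c 1 = Q c := by
    ext a
    simp only [Matrix.mulVec_single_one, Matrix.col_apply]
    simpa using hQ.isHermitian.apply c a
  have h1 := posSemidef_sq_le hQ (Q c) (Pi.single c 1)
  have h2 := quadForm_le_trace hQ (Q c)
  rw [single_quadForm, hc] at h1
  have h3 := hQ.diag_nonneg (i := c)
  rcases (dotProduct_self_nonneg' (Q c)).eq_or_lt with h0 | h0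
  · rw [← h0]; exact mul_nonneg hQ.trace_nonneg h3
  · refine le_of_mul_le_mul_right ?_ h0
    simp only [Matrix.diag_apply]
    nlinarith [mul_le_mul_of_nonneg_right h2 h3]

end QuadraticForms

/-! ### Powers of the weight matrix. -/

section Network

variable {n : ℕ} (G : SensorNetwork n)

theorem SensorNetwork.weight_pow_nonneg (d : ℕ) (i j : Fin n) : 0 ≤ (G.weight ^ d) i j := by
  induction d generalizing i with
  | zero => rw [pow_zero, Matrix.one_apply]; split_ifs <;> norm_num
  | succ d ih =>
    rw [pow_succ', Matrix.mul_apply]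
    exact Finset.sum_nonneg fun l _ => mul_nonneg (G.weight_nonneg i l) (ih l)

theorem SensorNetwork.weight_pow_row_sum (d : ℕ) (i : Fin n) : ∑ j, (G.weight ^ d) i j = 1 := by
  induction d generalizing i with
  | zero => simp [Matrix.one_apply]
  | succ d ih =>
    simp_rw [pow_succ', Matrix.mul_apply]
    rw [Finset.sum_comm]
    simp_rw [← Finset.mul_sum, ih, mul_one]
    exact G.weight_row_sum i

theorem SensorNetwork.weight_col_sum (j : Fin n) : ∑ i, G.weight i j = 1 := by
  simp_rw [G.weight_symm _ j]
  exact G.weight_row_sum j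

/-- Beyond the diameter, further powers only take convex combinations of entries of one column of
the diameter power. -/
theorem SensorNetwork.aMin_le_weight_pow {d : ℕ} (hd : G.diameter ≤ d) (i j : Fin n) :
    G.aMin ≤ (G.weight ^ d) i j := by
  have h : ∀ l, G.aMin ≤ (G.weight ^ G.diameter) l j := fun l =>
    ciInf_le (Set.finite_range _).bddBelow (l, j)
  obtain ⟨e, rfl⟩ := Nat.exists_eq_add_of_le' hd
  rw [pow_add, Matrix.mul_apply]
  calc G.aMin = ∑ l, (G.weight ^ e) i l * G.aMin := by
        rw [← Finset.sum_mul, G.weight_pow_row_sum, one_mul]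
    _ ≤ _ := Finset.sum_le_sum fun l _ =>
        mul_le_mul_of_nonneg_left (h l) (G.weight_pow_nonneg e i l)

theorem SensorNetwork.aMin_le_one [NeZero n] : G.aMin ≤ 1 :=
  (G.aMin_le_weight_pow le_rfl 0 0).trans <|
    (Finset.single_le_sum (f := fun j => (G.weight ^ G.diameter) 0 j)
      (fun j _ => G.weight_pow_nonneg _ 0 j) (Finset.mem_univ 0)).trans_eq
      (G.weight_pow_row_sum _ 0)

/-- Averaging with a symmetric stochastic matrix is a contraction of the spectral norm. -/
theorem SensorNetwork.norm_kronecker_one_le (m : ℕ) :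
    ‖G.weight ⊗ₖ (1 : Matrix (Fin m) (Fin m) ℝ)‖ ≤ 1 := by
  refine l2_opNorm_le_of_quadForm zero_le_one fun x => ?_
  have key : ∀ i a, ((G.weight ⊗ₖ (1 : Matrix (Fin m) (Fin m) ℝ)) *ᵥ x) (i, a)
      = ∑ j, G.weight i j * x (j, a) := by
    intro i a
    simp [Matrix.mulVec, dotProduct, Fintype.sum_prod_type, Matrix.kroneckerMap_apply,
      Matrix.one_apply]
  rw [one_pow, one_mul, dotProduct, dotProduct, Fintype.sum_prod_type, Fintype.sum_prod_type]
  simp_rw [key, ← sq]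
  calc ∑ i, ∑ a, (∑ j, G.weight i j * x (j, a)) ^ 2
      ≤ ∑ i, ∑ a, ∑ j, G.weight i j * x (j, a) ^ 2 :=
        Finset.sum_le_sum fun i _ => Finset.sum_le_sum fun a _ =>
          Real.pow_arith_mean_le_arith_mean_pow_of_even _ _ _ (fun j _ => G.weight_nonneg i j)
            (G.weight_row_sum i) even_two
    _ = ∑ j, ∑ a, (∑ i, G.weight i j) * x (j, a) ^ 2 := by
        simp_rw [Finset.sum_mul]
        rw [Finset.sum_comm, Finset.sum_comm (t := Finset.univ (α := Fin m))]
        refine Finset.sum_congr rfl fun a _ => ?_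
        rw [Finset.sum_comm]
    _ = _ := by simp_rw [G.weight_col_sum, one_mul]

end Network

/-! ### Algebra of block diagonal matrices. -/

section BlockDiagonal

variable {n m : ℕ}

theorem blockDiag_apply (P : Fin n → Matrix (Fin m) (Fin m) ℝ) (u v : Fin n × Fin m) :
    blockDiag P u v = if u.1 = v.1 then P u.1 u.2 v.2 else 0 := by
  simp [blockDiag, Matrix.blockDiagonal_apply]

theorem blockDiag_mul (P Q : Fin n → Matrix (Fin m) (Fin m) ℝ) :
    blockDiag P * blockDiag Q = blockDiag fun i => P i * Q i := by
  ext u v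
  rw [Matrix.mul_apply, blockDiag_apply, Fintype.sum_prod_type]
  simp_rw [blockDiag_apply, Matrix.mul_apply]
  by_cases h : u.1 = v.1 <;> simp [h]

theorem blockDiag_one : blockDiag (fun _ : Fin n => (1 : Matrix (Fin m) (Fin m) ℝ)) = 1 := by
  ext u v
  rw [blockDiag_apply, Matrix.one_apply, Matrix.one_apply]
  by_cases h : u.1 = v.1 <;> simp [h, Prod.ext_iff]

theorem blockDiag_inv {R : Fin n → Matrix (Fin m) (Fin m) ℝ} (hR : ∀ i, IsUnit (R i).det) :
    (blockDiag fun i => (R i)⁻¹) = (blockDiag R)⁻¹ := by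
  symm
  refine Matrix.inv_eq_right_inv ?_
  rw [blockDiag_mul, ← blockDiag_one]
  congr 1
  funext i
  exact Matrix.mul_nonsing_inv _ (hR i)

theorem isUnit_det_blockDiag {R : Fin n → Matrix (Fin m) (Fin m) ℝ}
    (hR : ∀ i, IsUnit (R i).det) : IsUnit (blockDiag R).det := by
  refine Matrix.isUnit_det_of_right_inverse (B := blockDiag fun i => (R i)⁻¹) ?_
  rw [blockDiag_mul, ← blockDiag_one]
  congr 1
  funext i
  exact Matrix.mul_nonsing_inv _ (hR i)

theorem blockDiag_quadForm (R : Fin n → Matrix (Fin m) (Fin m) ℝ) (x : Fin n × Fin m → ℝ) :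
    x ⬝ᵥ (blockDiag R *ᵥ x) = ∑ i, (fun a => x (i, a)) ⬝ᵥ (R i *ᵥ fun a => x (i, a)) := by
  have h : ∀ i a, (blockDiag R *ᵥ x) (i, a) = (R i *ᵥ fun a => x (i, a)) a := by
    intro i a
    simp only [Matrix.mulVec, dotProduct, Fintype.sum_prod_type, blockDiag_apply]
    rw [Finset.sum_eq_single i (fun j _ hj => by simp [hj.symm]) (by simp)]
    simp
  rw [dotProduct, Fintype.sum_prod_type]
  simp_rw [h]
  rfl

theorem blockDiag_trace (R : Fin n → Matrix (Fin m) (Fin m) ℝ) :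
    (blockDiag R).trace = ∑ i, (R i).trace := by
  simp [Matrix.trace, Fintype.sum_prod_type, blockDiag_apply]

theorem blockDiag_posSemidef {R : Fin n → Matrix (Fin m) (Fin m) ℝ}
    (hR : ∀ i, (R i).PosSemidef) : (blockDiag R).PosSemidef := by
  refine Matrix.PosSemidef.of_dotProduct_mulVec_nonneg ?_ fun x => ?_
  · ext u v
    rw [Matrix.conjTranspose_apply, star_trivial, blockDiag_apply, blockDiag_apply]
    by_cases h : u.1 = v.1
    · rw [if_pos h, if_pos h.symm, h]
      simpa using (hR v.1).isHermitian.apply u.2 v.2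
    · rw [if_neg h, if_neg (Ne.symm h)]
  · rw [star_trivial, blockDiag_quadForm]
    exact Finset.sum_nonneg fun i _ => posSemidef_quadForm_nonneg (hR i) _

end BlockDiagonal

/-! ### The linear recursion of the information matrices and the telescoping product. -/

section Information

variable {n m : ℕ} (G : SensorNetwork n) (α : ℝ) (φ : ℕ → Fin n → Fin m → ℝ)
  (P₀ : Fin n → Matrix (Fin m) (Fin m) ℝ)

/-- The information matrices, that is, the inverses of the gain matrices. -/
def info : ℕ → Fin n → Matrix (Fin m) (Fin m) ℝ
  | 0, i => (P₀ i)⁻¹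
  | t + 1, i => ∑ j, G.weight i j • (α • info t j + Matrix.vecMulVec (φ t j) (φ t j))

variable {α} {P₀}

theorem posSemidef_vecMulVec_self (v : Fin m → ℝ) : (Matrix.vecMulVec v v).PosSemidef := by
  simpa using Matrix.posSemidef_vecMulVec_self_star v

theorem info_posDef (hα : 0 < α) (hP₀ : ∀ i, (P₀ i).PosDef) (t : ℕ) (i : Fin n) :
    (info G α φ P₀ t i).PosDef := by
  induction t generalizing i with
  | zero => exact (hP₀ i).inv
  | succ t ih =>
    have h : ∀ j, (α • info G α φ P₀ t j + Matrix.vecMulVec (φ t j) (φ t j)).PosDef := fun j =>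
      ((ih j).smul hα).add_posSemidef (posSemidef_vecMulVec_self _)
    rw [info, ← Finset.add_sum_erase _ _ (Finset.mem_univ i)]
    exact ((h i).smul (G.weight_self_pos i)).add_posSemidef
      (Matrix.posSemidef_sum _ fun j _ => (h j).posSemidef.smul (G.weight_nonneg i j))

theorem info_isUnit_det (hα : 0 < α) (hP₀ : ∀ i, (P₀ i).PosDef) (t : ℕ) (i : Fin n) :
    IsUnit (info G α φ P₀ t i).det :=
  (Matrix.isUnit_iff_isUnit_det _).1 (info_posDef G φ hα hP₀ t i).isUnit

/-- The Sherman-Morrison formula: it is what makes the algorithm linear in the inverse gains. -/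
theorem adaptP_inv (hα : 0 < α) {P : Matrix (Fin m) (Fin m) ℝ} (hP : P.PosDef)
    (v : Fin m → ℝ) : (adaptP α P v)⁻¹ = α • P⁻¹ + Matrix.vecMulVec v v := by
  refine Matrix.inv_eq_right_inv ?_
  have hu : IsUnit P.det := (Matrix.isUnit_iff_isUnit_det P).1 hP.isUnit
  have hs : 0 ≤ v ⬝ᵥ (P *ᵥ v) := posSemidef_quadForm_nonneg hP.posSemidef v
  set s := v ⬝ᵥ (P *ᵥ v) with hsdef
  have h1 : Matrix.vecMulVec v v * P * Matrix.vecMulVec v v = s • Matrix.vecMulVec v v := by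
    rw [Matrix.mul_assoc, Matrix.mul_vecMulVec, Matrix.vecMulVec_mul_vecMulVec, ← hsdef]
    ext a b
    simp [Matrix.vecMulVec_apply]
    ring
  have hPP : P * P⁻¹ = 1 := Matrix.mul_nonsing_inv _ hu
  rw [adaptP, ← hsdef, Matrix.smul_mul, Matrix.mul_add, Matrix.sub_mul, Matrix.sub_mul,
    Matrix.smul_mul, Matrix.smul_mul, Matrix.mul_smul, Matrix.mul_smul,
    Matrix.mul_assoc (P * Matrix.vecMulVec v v), hPP, Matrix.mul_one, Matrix.mul_assoc P,
    Matrix.mul_assoc P, h1, Matrix.mul_smul]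
  have hne : α + s ≠ 0 := by positivity
  ext a b
  simp only [Matrix.smul_apply, Matrix.add_apply, Matrix.sub_apply, smul_eq_mul]
  field_simp
  ring

theorem sum_neighbors_smul (i : Fin n) (f : Fin n → Matrix (Fin m) (Fin m) ℝ) :
    ∑ j ∈ G.neighbors i, G.weight i j • f j = ∑ j, G.weight i j • f j := by
  refine Finset.sum_subset (Finset.subset_univ _) fun j _ hj => ?_
  have h : G.weight i j = 0 := by
    rw [SensorNetwork.neighbors, Finset.mem_filter, not_and, not_lt, G.weight_symm] at hj
    exact le_antisymm (hj (Finset.mem_univ j)) (G.weight_nonneg i j)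
  rw [h, zero_smul]

theorem ffls_P_eq (hα : 0 < α) (hP₀ : ∀ i, (P₀ i).PosDef) (y : ℕ → Fin n → ℝ)
    (θ₀ : Fin n → Fin m → ℝ) (t : ℕ) (i : Fin n) :
    (ffls G α φ y θ₀ P₀ t).P i = (info G α φ P₀ t i)⁻¹ := by
  induction t generalizing i with
  | zero =>
    rw [ffls, info, Matrix.nonsing_inv_nonsing_inv]
    exact (Matrix.isUnit_iff_isUnit_det _).1 (hP₀ i).isUnit
  | succ t ih =>
    change (∑ j ∈ G.neighbors i, G.weight i j •
      (adaptP α ((ffls G α φ y θ₀ P₀ t).P j) (φ t j))⁻¹)⁻¹ = _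
    rw [sum_neighbors_smul, info]
    simp_rw [ih]
    congr 1
    refine Finset.sum_congr rfl fun j _ => ?_
    rw [adaptP_inv hα (info_posDef G φ hα hP₀ t j).inv, Matrix.nonsing_inv_nonsing_inv]
    exact info_isUnit_det G φ hα hP₀ t j

theorem blockDiag_ffls_P (hα : 0 < α) (hP₀ : ∀ i, (P₀ i).PosDef) (y : ℕ → Fin n → ℝ)
    (θ₀ : Fin n → Fin m → ℝ) (t : ℕ) :
    blockDiag (ffls G α φ y θ₀ P₀ t).P = (blockDiag (info G α φ P₀ t))⁻¹ := by
  rw [← blockDiag_inv fun i => info_isUnit_det G φ hα hP₀ t i]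
  congr 1
  funext i
  exact ffls_P_eq G φ hα hP₀ y θ₀ t i

/-- The products of the error matrices telescope. -/
theorem orderedProd_errorMatrix (hα : 0 < α) (hP₀ : ∀ i, (P₀ i).PosDef) (y : ℕ → Fin n → ℝ)
    (θ₀ : Fin n → Fin m → ℝ) (k d : ℕ) :
    orderedProd (errorMatrix G α φ y θ₀ P₀) k d =
      α ^ d • ((blockDiag (info G α φ P₀ (k + d + 1)))⁻¹ *
        (G.weight ⊗ₖ (1 : Matrix (Fin m) (Fin m) ℝ)) ^ d * blockDiag (info G α φ P₀ (k + 1))) := by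
  have hu := fun t => isUnit_det_blockDiag fun i => info_isUnit_det G φ hα hP₀ t i
  induction d with
  | zero => simp [orderedProd, Matrix.nonsing_inv_mul _ (hu (k + 1))]
  | succ d ih =>
    rw [orderedProd, ih, errorMatrix, blockDiag_ffls_P G φ hα hP₀, blockDiag_ffls_P G φ hα hP₀,
      Matrix.nonsing_inv_nonsing_inv _ (hu _), Matrix.smul_mul, Matrix.mul_smul, smul_smul,
      ← pow_succ', ← add_assoc]
    congr 1
    simp only [Matrix.mul_assoc]
    -- The last factor of the new error matrix is the information at time k + d + 1, which meets its
    -- own inverse from the previous product.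
    rw [← Matrix.mul_assoc (blockDiag (info G α φ P₀ (k + d + 1))),
      Matrix.mul_nonsing_inv _ (hu _), Matrix.one_mul, pow_succ', Matrix.mul_assoc]

theorem norm_orderedProd_errorMatrix_le (hα : 0 < α) (hP₀ : ∀ i, (P₀ i).PosDef)
    (y : ℕ → Fin n → ℝ) (θ₀ : Fin n → Fin m → ℝ) (k d : ℕ) :
    ‖orderedProd (errorMatrix G α φ y θ₀ P₀) k d‖ ≤
      α ^ d * (‖(blockDiag (info G α φ P₀ (k + d + 1)))⁻¹‖ *
        ∑ i, (info G α φ P₀ (k + 1) i).trace) := by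
  rw [orderedProd_errorMatrix G φ hα hP₀, norm_smul, Real.norm_of_nonneg (by positivity)]
  refine mul_le_mul_of_nonneg_left ?_ (by positivity)
  refine (Matrix.l2_opNorm_mul _ _).trans ?_
  have hA : ‖(G.weight ⊗ₖ (1 : Matrix (Fin m) (Fin m) ℝ)) ^ d‖ ≤ 1 ∨ d = 0 := by
    rcases Nat.eq_zero_or_pos d with h | h
    · exact Or.inr h
    · exact Or.inl ((norm_pow_le' _ h).trans (pow_le_one₀ (norm_nonneg _)
        (G.norm_kronecker_one_le m)))
  refine mul_le_mul ?_ ?_ (norm_nonneg _) (norm_nonneg _)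
  · rcases hA with hA | rfl
    · exact (Matrix.l2_opNorm_mul _ _).trans (mul_le_of_le_one_right (norm_nonneg _) hA)
    · simp
  · rw [← blockDiag_trace]
    exact l2_opNorm_le_trace (blockDiag_posSemidef fun i => (info_posDef G φ hα hP₀ _ i).posSemidef)

/-- The columns of the weight matrix also sum to one, so averaging preserves the total trace. -/
theorem sum_trace_info_succ (t : ℕ) :
    ∑ i, (info G α φ P₀ (t + 1) i).trace =
      α * ∑ i, (info G α φ P₀ t i).trace + ∑ j, φ t j ⬝ᵥ φ t j := by
  simp_rw [info, Matrix.trace_sum, Matrix.trace_smul, Matrix.trace_add, Matrix.trace_smul,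
    Matrix.trace_vecMulVec, smul_eq_mul]
  rw [Finset.sum_comm]
  simp_rw [← Finset.sum_mul, G.weight_col_sum, one_mul, Finset.sum_add_distrib, Finset.mul_sum]

/-- The recursion unrolled. A regressor of time k enters undiscounted but is averaged at once, so it
has t - k averagings and only t - 1 - k discounts. -/
theorem info_quadForm (t : ℕ) (i : Fin n) (x : Fin m → ℝ) :
    x ⬝ᵥ (info G α φ P₀ t i *ᵥ x) =
      α ^ t * ∑ j, (G.weight ^ t) i j * (x ⬝ᵥ ((P₀ j)⁻¹ *ᵥ x)) +
        ∑ k ∈ Finset.range t,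
          α ^ (t - 1 - k) * ∑ j, (G.weight ^ (t - k)) i j * (φ k j ⬝ᵥ x) ^ 2 := by
  induction t generalizing i with
  | zero => simp [info, Matrix.one_apply]
  | succ t ih =>
    have h1 : x ⬝ᵥ (info G α φ P₀ (t + 1) i *ᵥ x) =
        ∑ l, G.weight i l * (α * (x ⬝ᵥ (info G α φ P₀ t l *ᵥ x)) + (φ t l ⬝ᵥ x) ^ 2) := by
      rw [info, Matrix.sum_mulVec, dotProduct_sum]
      refine Finset.sum_congr rfl fun l _ => ?_
      rw [Matrix.smul_mulVec, dotProduct_smul, Matrix.add_mulVec, dotProduct_add,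
        Matrix.smul_mulVec, dotProduct_smul, dotProduct_mulVec_vecMulVec_self, smul_eq_mul,
        smul_eq_mul]
    have h2 : ∀ (d : ℕ) (f : Fin n → ℝ), ∑ l, G.weight i l * ∑ j, (G.weight ^ d) l j * f j =
        ∑ j, (G.weight ^ (d + 1)) i j * f j := by
      intro d f
      simp_rw [Finset.mul_sum, pow_succ', Matrix.mul_apply, Finset.sum_mul, mul_assoc]
      rw [Finset.sum_comm]
    rw [h1, Finset.sum_range_succ]
    simp_rw [ih, mul_add, Finset.sum_add_distrib]
    have h3 : t + 1 - t = 1 := by omega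
    have h4 : t + 1 - 1 - t = 0 := by omega
    rw [h3, h4, pow_zero, one_mul, pow_one, ← add_assoc]
    congr 2
    · rw [← h2, Finset.mul_sum]
      refine Finset.sum_congr rfl fun l _ => ?_
      ring
    · simp_rw [Finset.mul_sum (s := Finset.range t)]
      rw [Finset.sum_comm]
      refine Finset.sum_congr rfl fun k hk => ?_
      have hk' := Finset.mem_range.1 hk
      have e1 : t + 1 - k = t - k + 1 := by omega
      have e2 : t + 1 - 1 - k = t - 1 - k + 1 := by omega
      rw [e1, e2, ← h2, Finset.mul_sum]
      refine Finset.sum_congr rfl fun l _ => ?_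
      ring

end Information

/-! ### The smallest eigenvalue as a lower bound for the form. -/

section MinEigenvalue

variable {m : ℕ}

theorem minEigenvalue_mul_le {A : Matrix (Fin m) (Fin m) ℝ} (hA : A.IsHermitian)
    (x : Fin m → ℝ) : minEigenvalue A * (x ⬝ᵥ x) ≤ x ⬝ᵥ (A *ᵥ x) := by
  have hbdd : BddBelow (spectrum ℝ A) := by
    rw [hA.spectrum_real_eq_range_eigenvalues]
    exact (Set.finite_range _).bddBelow
  have hH : (A - minEigenvalue A • 1).IsHermitian :=
    hA.sub ((Matrix.isHermitian_one).smul (by simp [IsSelfAdjoint]))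
  have hpsd : (A - minEigenvalue A • 1).PosSemidef := by
    rw [hH.posSemidef_iff_eigenvalues_nonneg]
    intro i
    have h1 : hH.eigenvalues i ∈ spectrum ℝ (A - minEigenvalue A • 1) := by
      rw [hH.spectrum_real_eq_range_eigenvalues]
      exact ⟨i, rfl⟩
    have h2 : hH.eigenvalues i + minEigenvalue A ∈ spectrum ℝ A := by
      have := (spectrum.add_mem_add_iff (s := minEigenvalue A)).2 h1
      rwa [Algebra.algebraMap_eq_smul_one, add_sub_cancel] at this
    have h3 : minEigenvalue A ≤ hH.eigenvalues i + minEigenvalue A := csInf_le hbdd h2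
    simpa using h3
  have h := posSemidef_quadForm_nonneg hpsd x
  rw [Matrix.sub_mulVec, dotProduct_sub, Matrix.smul_mulVec, Matrix.one_mulVec,
    dotProduct_smul, smul_eq_mul] at h
  linarith

end MinEigenvalue

/-! ### One-step contraction of the trace of the inverse. -/

section Contraction

variable {m : ℕ}

/-- The relative decrease of the trace of the inverse of `S` when `B` is added to `S`. -/
def gain (S B : Matrix (Fin m) (Fin m) ℝ) : ℝ :=
  (∑ c, (S⁻¹ c) ⬝ᵥ (B *ᵥ (S⁻¹ c))) / (S⁻¹.trace * (1 + S⁻¹.trace))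

/-- The contraction factor of the trace of the inverse of `S` when `B` is added to `S`. -/
def contraction (S B : Matrix (Fin m) (Fin m) ℝ) : ℝ :=
  1 - (gain S B + 1 / (m * (1 + S⁻¹.trace))) / 2

theorem trace_inv_pos [NeZero m] {S : Matrix (Fin m) (Fin m) ℝ} (hS : S.PosDef) :
    0 < S⁻¹.trace := hS.inv.trace_pos

theorem gain_nonneg {S B : Matrix (Fin m) (Fin m) ℝ} (hS : S.PosDef) (hB : B.PosSemidef) :
    0 ≤ gain S B := by
  have := hS.inv.posSemidef.trace_nonneg
  exact div_nonneg (Finset.sum_nonneg fun c _ => posSemidef_quadForm_nonneg hB _) (by positivity)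

theorem gain_le [NeZero m] {S B : Matrix (Fin m) (Fin m) ℝ} (hS : S.PosDef)
    (hB1 : ∀ x : Fin m → ℝ, x ⬝ᵥ (B *ᵥ x) ≤ x ⬝ᵥ x) :
    gain S B ≤ 1 - 1 / (1 + S⁻¹.trace) := by
  have hy := trace_inv_pos hS
  have h1 : ∑ c, (S⁻¹ c) ⬝ᵥ (B *ᵥ (S⁻¹ c)) ≤ S⁻¹.trace ^ 2 :=
    (Finset.sum_le_sum fun c _ => hB1 _).trans (sum_sq_le_trace_sq hS.inv.posSemidef)
  rw [gain, div_le_iff₀ (by positivity)]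
  refine h1.trans_eq ?_
  field_simp
  ring

theorem contraction_le_one {S B : Matrix (Fin m) (Fin m) ℝ} (hS : S.PosDef)
    (hB : B.PosSemidef) : contraction S B ≤ 1 := by
  have h1 := gain_nonneg hS hB
  have h2 := hS.inv.posSemidef.trace_nonneg
  have h3 : 0 ≤ 1 / (m * (1 + S⁻¹.trace)) := by positivity
  rw [contraction]
  linarith

theorem one_div_card_mul_le [NeZero m] {y : ℝ} (hy : 0 < y) :
    1 / ((m : ℝ) * (1 + y)) ≤ 1 / (1 + y) := by
  have hm : (1 : ℝ) ≤ m := by exact_mod_cast NeZero.one_le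
  exact one_div_le_one_div_of_le (by positivity) (le_mul_of_one_le_left (by positivity) hm)

/-- The two subtracted terms together are at most 1 before halving. This bound away from zero is
what later permits division by conditional means. -/
theorem half_le_contraction [NeZero m] {S B : Matrix (Fin m) (Fin m) ℝ} (hS : S.PosDef)
    (hB1 : ∀ x : Fin m → ℝ, x ⬝ᵥ (B *ᵥ x) ≤ x ⬝ᵥ x) : 1 / 2 ≤ contraction S B := by
  have h1 := gain_le hS hB1
  have h2 := one_div_card_mul_le (m := m) (trace_inv_pos hS)
  rw [contraction]
  linarith

/-- Only half of the available gain is used. The other term of the factor costs at most y/(2m(1 +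
y)) with y the trace of S⁻¹, which the additive 1 absorbs. -/
theorem trace_inv_add_le_contraction [NeZero m] {S B : Matrix (Fin m) (Fin m) ℝ}
    (hS : S.PosDef) (hB : B.PosSemidef) (hB1 : ∀ x : Fin m → ℝ, x ⬝ᵥ (B *ᵥ x) ≤ x ⬝ᵥ x) :
    (S + B)⁻¹.trace ≤ contraction S B * S⁻¹.trace + 1 := by
  have h1 := trace_inv_add_le hS hB hB1
  have hy := trace_inv_pos hS
  have h2 : (∑ c, (S⁻¹ c) ⬝ᵥ (B *ᵥ (S⁻¹ c))) / (1 + S⁻¹.trace) = gain S B * S⁻¹.trace := by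
    rw [gain]
    field_simp
  have h3 := one_div_card_mul_le (m := m) hy
  have h4 : 1 / ((m : ℝ) * (1 + S⁻¹.trace)) * S⁻¹.trace ≤ 1 := by
    refine (mul_le_mul_of_nonneg_right h3 hy.le).trans ?_
    rw [one_div_mul_eq_div, div_le_one (by positivity)]
    linarith
  have h5 := mul_nonneg (gain_nonneg hS hB) hy.le
  rw [h2] at h1
  rw [contraction]
  nlinarith

/-- With y the trace of S⁻¹, the gain alone gives (l/m) · y/(1 + y), which degenerates for small y.
The correction 1/(m(1 + y)) supplies the missing (l/m)/(1 + y), so the bound no longer depends on S.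
-/
theorem contraction_le_of_le_quadForm [NeZero m] {S B : Matrix (Fin m) (Fin m) ℝ} {l : ℝ}
    (hS : S.PosDef) (hl0 : 0 ≤ l) (hl : l ≤ 1)
    (hB : ∀ x : Fin m → ℝ, l * (x ⬝ᵥ x) ≤ x ⬝ᵥ (B *ᵥ x)) :
    contraction S B ≤ 1 - l / (2 * m) := by
  have hy := trace_inv_pos hS
  have hm : (0 : ℝ) < m := by exact_mod_cast NeZero.pos m
  have h1 : l * ∑ c, (S⁻¹ c) ⬝ᵥ (S⁻¹ c) ≤ ∑ c, (S⁻¹ c) ⬝ᵥ (B *ᵥ (S⁻¹ c)) := by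
    rw [Finset.mul_sum]
    exact Finset.sum_le_sum fun c _ => hB _
  have h2 := trace_sq_le_card_mul_sum_sq S⁻¹
  rw [Fintype.card_fin] at h2
  have h3 : l / m * (S⁻¹.trace / (1 + S⁻¹.trace)) ≤ gain S B := by
    rw [gain, le_div_iff₀ (by positivity)]
    refine le_trans (le_of_eq ?_) (le_trans (mul_le_mul_of_nonneg_left
      ((div_le_iff₀' hm).2 h2) hl0) h1)
    field_simp
  have h4 : l / m * (1 / (1 + S⁻¹.trace)) ≤ 1 / (m * (1 + S⁻¹.trace)) := by
    rw [div_mul_div_comm, mul_one]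
    exact div_le_div_of_nonneg_right hl (by positivity)
  have h5 : l / m * (S⁻¹.trace / (1 + S⁻¹.trace)) + l / m * (1 / (1 + S⁻¹.trace)) = l / m := by
    field_simp
    ring
  have h6 : l / (2 * m) = l / m / 2 := by field_simp
  rw [contraction, h6]
  linarith

/-- The coefficients of `contraction S B` as an affine function of `B`. -/
def contractionCoeff (S : Matrix (Fin m) (Fin m) ℝ) (a b : Fin m) : ℝ :=
  (∑ c, S⁻¹ c a * S⁻¹ c b) / (S⁻¹.trace * (1 + S⁻¹.trace)) / 2

/-- Being affine in B, the factor commutes with conditional expectation when S is known. -/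
theorem contraction_eq_sub_sum (S B : Matrix (Fin m) (Fin m) ℝ) :
    contraction S B = (1 - 1 / (m * (1 + S⁻¹.trace)) / 2) -
      ∑ a, ∑ b, contractionCoeff S a b * B a b := by
  have h : gain S B / 2 = ∑ a, ∑ b, contractionCoeff S a b * B a b := by
    simp_rw [gain, contractionCoeff, dotProduct, Matrix.mulVec, dotProduct, Finset.mul_sum,
      Finset.sum_div, Finset.sum_mul]
    rw [Finset.sum_comm]
    refine Finset.sum_congr rfl fun a _ => ?_
    rw [Finset.sum_comm]
    refine Finset.sum_congr rfl fun b _ => Finset.sum_congr rfl fun c _ => ?_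
    ring
  rw [← h, contraction]
  ring

theorem abs_contractionCoeff_le [NeZero m] {S : Matrix (Fin m) (Fin m) ℝ} (hS : S.PosDef)
    (a b : Fin m) : |contractionCoeff S a b| ≤ 1 := by
  have hy := trace_inv_pos hS
  have h1 := sum_sq_le_trace_sq hS.inv.posSemidef
  have h2 : |∑ c, S⁻¹ c a * S⁻¹ c b| ≤ S⁻¹.trace ^ 2 := by
    refine (Finset.abs_sum_le_sum_abs _ _).trans (le_trans (Finset.sum_le_sum fun c _ => ?_) h1)
    have h3 : ∀ d, S⁻¹ c d ^ 2 ≤ (S⁻¹ c) ⬝ᵥ (S⁻¹ c) := fun d => by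
      rw [sq]
      exact Finset.single_le_sum (f := fun e => S⁻¹ c e * S⁻¹ c e)
        (fun e _ => mul_self_nonneg _) (Finset.mem_univ d)
    have ha := h3 a
    have hb := h3 b
    rw [abs_mul]
    rw [← sq_abs] at ha hb
    nlinarith [sq_nonneg (|S⁻¹ c a| - |S⁻¹ c b|)]
  have hden : 0 < S⁻¹.trace * (1 + S⁻¹.trace) := by positivity
  rw [contractionCoeff, abs_div, abs_div, abs_of_pos hden, abs_of_pos (zero_lt_two' ℝ), div_div,
    div_le_one (by positivity)]
  nlinarith

end Contraction

/-! ### The discounted accumulation and its unrolled trace bound. -/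

section Accumulation

variable {m : ℕ} {β : ℝ} {B : ℕ → Matrix (Fin m) (Fin m) ℝ}

variable (β B) in
/-- Discounted accumulation of a sequence of matrices. -/
def accum : ℕ → Matrix (Fin m) (Fin m) ℝ
  | 0 => 1
  | t + 1 => β • (accum t + B t)

theorem accum_posDef (hβ : 0 < β) (hB : ∀ t, (B t).PosSemidef) (t : ℕ) :
    (accum β B t).PosDef := by
  induction t with
  | zero => exact Matrix.PosDef.one
  | succ t ih => exact (ih.add_posSemidef (hB t)).smul hβ

theorem accum_quadForm (t : ℕ) (x : Fin m → ℝ) :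
    x ⬝ᵥ (accum β B t *ᵥ x) =
      β ^ t * (x ⬝ᵥ x) + ∑ s ∈ Finset.range t, β ^ (t - s) * (x ⬝ᵥ (B s *ᵥ x)) := by
  induction t with
  | zero => simp [accum]
  | succ t ih =>
    rw [accum, Matrix.smul_mulVec, dotProduct_smul, Matrix.add_mulVec, dotProduct_add, ih,
      Finset.sum_range_succ, smul_eq_mul, add_tsub_cancel_left, pow_one, mul_add, mul_add,
      Finset.mul_sum, pow_succ', mul_assoc, ← add_assoc]
    congr 2
    refine Finset.sum_congr rfl fun s hs => ?_
    rw [Nat.succ_sub (Finset.mem_range.1 hs).le, pow_succ']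
    ring

theorem trace_inv_accum_succ_le [NeZero m] (hβ : 0 < β) (hB : ∀ t, (B t).PosSemidef)
    (hB1 : ∀ t (x : Fin m → ℝ), x ⬝ᵥ (B t *ᵥ x) ≤ x ⬝ᵥ x) (t : ℕ) :
    (accum β B (t + 1))⁻¹.trace ≤
      β⁻¹ * (contraction (accum β B t) (B t) * (accum β B t)⁻¹.trace + 1) := by
  have hS := accum_posDef hβ hB t
  have hu : IsUnit (accum β B t + B t).det :=
    (Matrix.isUnit_iff_isUnit_det _).1 (hS.add_posSemidef (hB t)).isUnit
  have h : (accum β B (t + 1))⁻¹ = β⁻¹ • (accum β B t + B t)⁻¹ := by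
    refine Matrix.inv_eq_right_inv ?_
    rw [accum, Matrix.smul_mul, Matrix.mul_smul, Matrix.mul_nonsing_inv _ hu, smul_smul,
      mul_inv_cancel₀ hβ.ne', one_smul]
  rw [h, Matrix.trace_smul, smul_eq_mul]
  exact mul_le_mul_of_nonneg_left (trace_inv_add_le_contraction hS (hB t) (hB1 t))
    (inv_nonneg.2 hβ.le)

theorem trace_inv_accum_le_sum [NeZero m] (hβ : 0 < β) (hB : ∀ t, (B t).PosSemidef)
    (hB1 : ∀ t (x : Fin m → ℝ), x ⬝ᵥ (B t *ᵥ x) ≤ x ⬝ᵥ x) (t : ℕ) :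
    (accum β B (t + 1))⁻¹.trace ≤
      ∑ s ∈ Finset.range (t + 1), β⁻¹ * (m + 1) * (β⁻¹ ^ (t - s) *
        ∏ j ∈ Finset.Ioc s t, contraction (accum β B j) (B j)) := by
  have hb : 0 < β⁻¹ := inv_pos.2 hβ
  have hu0 : ∀ j, 0 ≤ contraction (accum β B j) (B j) := fun j =>
    le_trans (by norm_num) (half_le_contraction (accum_posDef hβ hB j) (hB1 j))
  induction t with
  | zero =>
    have h1 := trace_inv_accum_succ_le hβ hB hB1 0
    have h2 : (accum β B 0)⁻¹.trace = m := by simp [accum]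
    rw [h2] at h1
    refine h1.trans ?_
    -- The accumulation starts at the identity, whose inverse has trace m; this is the source of the
    -- constant m + 1.
    have h3 := contraction_le_one (accum_posDef hβ hB 0) (hB 0)
    simp only [zero_add, Finset.range_one, Finset.sum_singleton, Finset.Ioc_self,
      Finset.prod_empty, tsub_self, pow_zero, mul_one]
    refine mul_le_mul_of_nonneg_left ?_ hb.le
    have := mul_le_mul_of_nonneg_right h3 (Nat.cast_nonneg (α := ℝ) m)
    linarith
  | succ t ih =>
    refine (trace_inv_accum_succ_le hβ hB hB1 (t + 1)).trans ?_
    rw [Finset.sum_range_succ, mul_add]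
    refine add_le_add ?_ ?_
    · refine (mul_le_mul_of_nonneg_left (mul_le_mul_of_nonneg_left ih (hu0 _)) hb.le).trans_eq ?_
      rw [Finset.mul_sum, Finset.mul_sum]
      refine Finset.sum_congr rfl fun s hs => ?_
      have hs' : s ≤ t := Nat.lt_succ_iff.1 (Finset.mem_range.1 hs)
      rw [Nat.succ_sub hs', pow_succ', Finset.prod_Ioc_succ_top (by omega)]
      ring
    · simp only [Finset.Ioc_self, Finset.prod_empty, tsub_self, pow_zero, mul_one]
      refine le_mul_of_one_le_right hb.le ?_
      have := Nat.cast_nonneg (α := ℝ) m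
      linarith

end Accumulation

/-! ### Bounds on the information of one window. -/

section Window

variable {Ω : Type*} {n m : ℕ}
  (φ : ℕ → Fin n → Ω → EuclideanSpace ℝ (Fin m)) (h : ℕ)

theorem windowInfo_quadForm (t : ℕ) (ω : Ω) (x : Fin m → ℝ) :
    x ⬝ᵥ (windowInfo φ h t ω *ᵥ x) = 1 / ((n : ℝ) * (1 + (h : ℝ))) *
      ∑ i, ∑ k ∈ Finset.Icc (t * h + 1) ((t + 1) * h),
        1 / (1 + ‖φ k i ω‖ ^ 2) * ((φ k i ω).ofLp ⬝ᵥ x) ^ 2 := by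
  rw [windowInfo, Matrix.smul_mulVec, dotProduct_smul, Matrix.sum_mulVec, dotProduct_sum,
    smul_eq_mul]
  congr 1
  refine Finset.sum_congr rfl fun i _ => ?_
  rw [Matrix.sum_mulVec, dotProduct_sum]
  refine Finset.sum_congr rfl fun k _ => ?_
  rw [Matrix.smul_mulVec, dotProduct_smul, dotProduct_mulVec_vecMulVec_self, smul_eq_mul]

theorem windowInfo_posSemidef (t : ℕ) (ω : Ω) : (windowInfo φ h t ω).PosSemidef := by
  refine Matrix.PosSemidef.smul (Matrix.posSemidef_sum _ fun i _ =>
    Matrix.posSemidef_sum _ fun k _ => (posSemidef_vecMulVec_self _).smul ?_) ?_ <;> positivity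

/-- There are nh normalized terms and the divisor is n(1 + h). The resulting gap below 1 keeps 1 -
λ_t at least 1/(1 + h). -/
theorem windowInfo_quadForm_le (t : ℕ) (ω : Ω) (x : Fin m → ℝ) :
    x ⬝ᵥ (windowInfo φ h t ω *ᵥ x) ≤ h / (1 + h) * (x ⬝ᵥ x) := by
  rw [windowInfo_quadForm]
  have hx := dotProduct_self_nonneg' x
  have h1 : ∀ k i, 1 / (1 + ‖φ k i ω‖ ^ 2) * ((φ k i ω).ofLp ⬝ᵥ x) ^ 2 ≤ x ⬝ᵥ x := by
    intro k i
    have h2 : ((φ k i ω).ofLp ⬝ᵥ x) ^ 2 ≤ ‖φ k i ω‖ ^ 2 * (x ⬝ᵥ x) := by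
      rw [show ‖φ k i ω‖ ^ 2 = (φ k i ω).ofLp ⬝ᵥ (φ k i ω).ofLp from norm_toLp_sq _]
      simpa only [dotProduct, ← sq] using
        Finset.sum_mul_sq_le_sq_mul_sq Finset.univ (φ k i ω).ofLp x
    rw [one_div_mul_eq_div, div_le_iff₀ (by positivity)]
    linarith
  have h3 : ∑ i : Fin n, ∑ k ∈ Finset.Icc (t * h + 1) ((t + 1) * h),
      1 / (1 + ‖φ k i ω‖ ^ 2) * ((φ k i ω).ofLp ⬝ᵥ x) ^ 2 ≤ n * (h * (x ⬝ᵥ x)) := by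
    refine (Finset.sum_le_sum fun i _ => Finset.sum_le_sum fun k _ => h1 k i).trans_eq ?_
    have hc : (t + 1) * h + 1 - (t * h + 1) = h := by
      rw [add_mul, one_mul]; omega
    simp [hc]
  refine (mul_le_mul_of_nonneg_left h3 (by positivity)).trans ?_
  rcases Nat.eq_zero_or_pos n with hn | hn
  · simp only [hn, Nat.cast_zero, zero_mul, mul_zero]
    positivity
  · have : (0 : ℝ) < n := by exact_mod_cast hn
    apply le_of_eq
    field_simp

theorem windowInfo_quadForm_le_self (t : ℕ) (ω : Ω) (x : Fin m → ℝ) :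
    x ⬝ᵥ (windowInfo φ h t ω *ᵥ x) ≤ x ⬝ᵥ x := by
  refine (windowInfo_quadForm_le φ h t ω x).trans ?_
  refine mul_le_of_le_one_left (dotProduct_self_nonneg' x) ?_
  rw [div_le_one (by positivity)]
  linarith

theorem windowInfo_quadForm_le_sum [NeZero n] (t : ℕ) (ω : Ω) (x : Fin m → ℝ) :
    x ⬝ᵥ (windowInfo φ h t ω *ᵥ x) ≤
      ∑ k ∈ Finset.Ioc (t * h) ((t + 1) * h), ∑ i, ((φ k i ω).ofLp ⬝ᵥ x) ^ 2 := by
  have hn : (1 : ℝ) ≤ n := by exact_mod_cast NeZero.one_le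
  have hh : (0 : ℝ) ≤ h := Nat.cast_nonneg h
  rw [windowInfo_quadForm, Finset.sum_comm (s := Finset.Ioc (t * h) ((t + 1) * h))]
  have h1 : 1 / ((n : ℝ) * (1 + (h : ℝ))) ≤ 1 := by
    rw [div_le_one (by positivity)]
    nlinarith
  refine (mul_le_of_le_one_left (by positivity) h1).trans ?_
  refine Finset.sum_le_sum fun i _ => ?_
  rw [show Finset.Icc (t * h + 1) ((t + 1) * h) = Finset.Ioc (t * h) ((t + 1) * h) by
    ext k; rw [Finset.mem_Icc, Finset.mem_Ioc, Nat.succ_le_iff]]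
  refine Finset.sum_le_sum fun k _ => mul_le_of_le_one_left (sq_nonneg _) ?_
  rw [div_le_one (by positivity)]
  have := sq_nonneg ‖φ k i ω‖
  linarith

theorem windowInfo_symm (t : ℕ) (ω : Ω) (a b : Fin m) :
    windowInfo φ h t ω a b = windowInfo φ h t ω b a := by
  simpa using (windowInfo_posSemidef φ h t ω).isHermitian.apply b a

theorem abs_windowInfo_le (t : ℕ) (ω : Ω) (a b : Fin m) : |windowInfo φ h t ω a b| ≤ 1 := by
  have h1 := posSemidef_sq_le (windowInfo_posSemidef φ h t ω) (Pi.single a 1) (Pi.single b 1)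
  have h2 : ∀ c : Fin m, Pi.single c 1 ⬝ᵥ (windowInfo φ h t ω *ᵥ Pi.single c 1) ≤ 1 := fun c => by
    simpa using windowInfo_quadForm_le_self φ h t ω (Pi.single c 1)
  have h3 := posSemidef_quadForm_nonneg (windowInfo_posSemidef φ h t ω)
    (Pi.single b 1)
  rw [← sq_le_one_iff_abs_le_one]
  refine le_trans ?_ (mul_le_one₀ (h2 a) h3 (h2 b))
  simpa using h1

end Window

/-! ### Domination of the information matrices from below by the accumulation. -/

section Comparison

variable {Ω : Type*} {n m : ℕ}

theorem sum_range_sum_Ioc (f : ℕ → ℝ) (h t : ℕ) :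
    ∑ s ∈ Finset.range t, ∑ k ∈ Finset.Ioc (s * h) ((s + 1) * h), f k =
      ∑ k ∈ Finset.Ioc 0 (t * h), f k := by
  induction t with
  | zero => simp
  | succ t ih =>
    rw [Finset.sum_range_succ, ih]
    exact Finset.sum_Ioc_consecutive f (Nat.zero_le _) (Nat.mul_le_mul_right h (Nat.le_succ t))

/-- Only windows ending by time t - D - 1 are kept, with D the diameter. Their regressors have been
averaged more than D times, so each weight is at least `aMin`. Discounting per window instead of per
step costs a fixed power of α. -/
theorem exists_accum_le_info [NeZero n] (G : SensorNetwork n) (haMin : 0 < G.aMin)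
    {α : ℝ} (hα : 0 < α) (hα1 : α ≤ 1) {P₀ : Fin n → Matrix (Fin m) (Fin m) ℝ}
    (hP₀ : ∀ i, (P₀ i).PosDef) (φ : ℕ → Fin n → Ω → EuclideanSpace ℝ (Fin m)) {h : ℕ}
    (hh : 0 < h) :
    ∃ c : ℝ, 0 < c ∧ ∀ ω t i (x : Fin m → ℝ),
      c * (x ⬝ᵥ (accum (α ^ h) (fun s => windowInfo φ h s ω) ((t - G.diameter - 1) / h) *ᵥ x)) ≤
        x ⬝ᵥ (info G α (fun s i => (φ s i ω).ofLp) P₀ t i *ᵥ x) := by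
  have htr : 0 ≤ ∑ j, (P₀ j).trace :=
    Finset.sum_nonneg fun j _ => (hP₀ j).posSemidef.trace_nonneg
  set r := (1 + ∑ j, (P₀ j).trace)⁻¹ with hr
  have hr0 : 0 < r := by positivity
  have hP : ∀ j (x : Fin m → ℝ), r * (x ⬝ᵥ x) ≤ x ⬝ᵥ ((P₀ j)⁻¹ *ᵥ x) := by
    intro j x
    have h1 := dotProduct_self_le_trace_inv_mul (hP₀ j).inv x
    rw [Matrix.nonsing_inv_nonsing_inv _ ((Matrix.isUnit_iff_isUnit_det _).1 (hP₀ j).isUnit)] at h1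
    have h2 := posSemidef_quadForm_nonneg (hP₀ j).inv.posSemidef x
    have h3 : (P₀ j).trace ≤ 1 + ∑ j, (P₀ j).trace :=
      (Finset.single_le_sum (f := fun j => (P₀ j).trace)
        (fun j _ => (hP₀ j).posSemidef.trace_nonneg) (Finset.mem_univ j)).trans (by linarith)
    rw [hr, inv_mul_le_iff₀ (by positivity)]
    exact h1.trans (mul_le_mul_of_nonneg_right h3 h2)
  -- E covers the delay of the diameter plus one and the incomplete last window: t ≤ qh + E, also
  -- when the subtraction truncates.
  set E := G.diameter + 1 + h with hE
  refine ⟨min r G.aMin * α ^ E, by positivity, fun ω t i x => ?_⟩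
  set c := min r G.aMin with hc
  have hc0 : 0 < c := lt_min hr0 haMin
  set q := (t - G.diameter - 1) / h with hq
  have hq1 : q * h ≤ t - G.diameter - 1 := Nat.div_mul_le_self _ _
  have hq2 : t - G.diameter - 1 < q * h + h := Nat.lt_div_mul_add hh
  have hx := dotProduct_self_nonneg' x
  set w : ℕ → ℝ := fun k => ∑ j, ((φ k j ω).ofLp ⬝ᵥ x) ^ 2 with hw
  have hw0 : ∀ k, 0 ≤ w k := fun k => Finset.sum_nonneg fun j _ => sq_nonneg _
  rw [accum_quadForm, info_quadForm, mul_add]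
  refine add_le_add ?_ ?_
  · have h1 : r * (x ⬝ᵥ x) ≤ ∑ j, (G.weight ^ t) i j * (x ⬝ᵥ ((P₀ j)⁻¹ *ᵥ x)) := by
      calc r * (x ⬝ᵥ x) = ∑ j, (G.weight ^ t) i j * (r * (x ⬝ᵥ x)) := by
            rw [← Finset.sum_mul, G.weight_pow_row_sum, one_mul]
        _ ≤ _ := Finset.sum_le_sum fun j _ =>
            mul_le_mul_of_nonneg_left (hP j x) (G.weight_pow_nonneg t i j)
    have h2 : α ^ E * (α ^ h) ^ q ≤ α ^ t := by
      rw [← pow_mul, ← pow_add]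
      refine pow_le_pow_of_le_one hα.le hα1 ?_
      rw [mul_comm h q]
      omega
    calc c * α ^ E * ((α ^ h) ^ q * (x ⬝ᵥ x)) = (α ^ E * (α ^ h) ^ q) * (c * (x ⬝ᵥ x)) := by ring
      _ ≤ α ^ t * (r * (x ⬝ᵥ x)) := by
          refine mul_le_mul h2 (mul_le_mul_of_nonneg_right (min_le_left _ _) hx)
            (by positivity) (by positivity)
      _ ≤ _ := mul_le_mul_of_nonneg_left h1 (by positivity)
  · have hsub : Finset.Ioc 0 (q * h) ⊆ Finset.range t := by
      intro k hk
      rw [Finset.mem_Ioc] at hk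
      rw [Finset.mem_range]
      omega
    have hnn : ∀ k, 0 ≤ α ^ (t - 1 - k) *
        ∑ j, (G.weight ^ (t - k)) i j * ((φ k j ω).ofLp ⬝ᵥ x) ^ 2 := fun k =>
      mul_nonneg (by positivity) (Finset.sum_nonneg fun j _ =>
        mul_nonneg (G.weight_pow_nonneg _ i j) (sq_nonneg _))
    refine le_trans ?_ (Finset.sum_le_sum_of_subset_of_nonneg hsub fun k _ _ => hnn k)
    rw [← sum_range_sum_Ioc, Finset.mul_sum]
    refine Finset.sum_le_sum fun s hs => ?_
    have hs' := Finset.mem_range.1 hs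
    have hsq : (s + 1) * h ≤ q * h := Nat.mul_le_mul_right h hs'
    calc c * α ^ E * ((α ^ h) ^ (q - s) * (x ⬝ᵥ (windowInfo φ h s ω *ᵥ x)))
        ≤ c * α ^ E * ((α ^ h) ^ (q - s) *
          ∑ k ∈ Finset.Ioc (s * h) ((s + 1) * h), w k) := by
          refine mul_le_mul_of_nonneg_left (mul_le_mul_of_nonneg_left
            (windowInfo_quadForm_le_sum φ h s ω x) (by positivity)) (by positivity)
      _ = ∑ k ∈ Finset.Ioc (s * h) ((s + 1) * h), (α ^ E * (α ^ h) ^ (q - s)) * (c * w k) := by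
          rw [Finset.mul_sum, Finset.mul_sum]
          exact Finset.sum_congr rfl fun k _ => by ring
      _ ≤ _ := by
          refine Finset.sum_le_sum fun k hk => ?_
          rw [Finset.mem_Ioc] at hk
          refine mul_le_mul ?_ ?_ (mul_nonneg hc0.le (hw0 k)) (by positivity)
          · rw [← pow_mul, ← pow_add]
            refine pow_le_pow_of_le_one hα.le hα1 ?_
            have h5 : h * (q - s) = q * h - s * h := by rw [Nat.mul_sub, mul_comm h, mul_comm h]
            rw [h5]
            omega
          · rw [hw, Finset.mul_sum]
            refine Finset.sum_le_sum fun j _ => mul_le_mul_of_nonneg_right ?_ (sq_nonneg _)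
            exact (min_le_right _ _).trans (G.aMin_le_weight_pow (by omega) i j)

/-- The form of the accumulation is at least |x|² divided by the trace of its inverse. The bound
holds block by block, since the comparison is uniform in the sensor. -/
theorem exists_norm_inv_info_le [NeZero n] [NeZero m] (G : SensorNetwork n)
    (haMin : 0 < G.aMin) {α : ℝ} (hα : 0 < α) (hα1 : α ≤ 1)
    {P₀ : Fin n → Matrix (Fin m) (Fin m) ℝ} (hP₀ : ∀ i, (P₀ i).PosDef)
    (φ : ℕ → Fin n → Ω → EuclideanSpace ℝ (Fin m)) {h : ℕ} (hh : 0 < h) :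
    ∃ C : ℝ, 0 < C ∧ ∀ ω t,
      ‖(blockDiag (info G α (fun s i => (φ s i ω).ofLp) P₀ t))⁻¹‖ ≤
        C * (accum (α ^ h) (fun s => windowInfo φ h s ω)
          ((t - G.diameter - 1) / h))⁻¹.trace := by
  obtain ⟨c, hc, hle⟩ := exists_accum_le_info G haMin hα hα1 hP₀ φ hh
  refine ⟨c⁻¹, inv_pos.2 hc, fun ω t => ?_⟩
  set S := accum (α ^ h) (fun s => windowInfo φ h s ω) ((t - G.diameter - 1) / h)
  have hS : S.PosDef := accum_posDef (by positivity) (fun s => windowInfo_posSemidef φ h s ω) _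
  have hy := trace_inv_pos hS
  rw [← inv_inv S⁻¹.trace, ← mul_inv]
  refine l2_opNorm_inv_le (by positivity)
    (isUnit_det_blockDiag fun i => info_isUnit_det G _ hα hP₀ t i) fun x => ?_
  rw [blockDiag_quadForm, dotProduct, Fintype.sum_prod_type, Finset.mul_sum]
  refine Finset.sum_le_sum fun i _ => ?_
  refine le_trans ?_ (hle ω t i _)
  rw [mul_assoc]
  refine mul_le_mul_of_nonneg_left ?_ hc.le
  rw [inv_mul_le_iff₀ hy]
  exact dotProduct_self_le_trace_inv_mul hS _

end Comparison

/-! ### From conditional means of the factors to moments of their product. -/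

section Decoupling

variable {Ω : Type*} [mΩ : MeasurableSpace Ω] {μ : Measure Ω} [IsProbabilityMeasure μ]

theorem integral_mul_condExp_of_bound {𝒢 : MeasurableSpace Ω} (h𝒢 : 𝒢 ≤ mΩ) {Z f : Ω → ℝ}
    (hZ : StronglyMeasurable[𝒢] Z) (hf : Integrable f μ) {c : ℝ} (hc : ∀ ω, |Z ω| ≤ c) :
    ∫ ω, Z ω * f ω ∂μ = ∫ ω, Z ω * (μ[f | 𝒢]) ω ∂μ := by
  have h := condExp_stronglyMeasurable_mul_of_bound h𝒢 hZ hf c (ae_of_all _ hc)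
  calc ∫ ω, Z ω * f ω ∂μ = ∫ ω, (μ[Z * f | 𝒢]) ω ∂μ := (integral_condExp h𝒢).symm
    _ = _ := integral_congr_ae h

/-- A product of ratios of adapted variables to their conditional expectations has mean one. -/
theorem integral_prod_div_eq_one (𝒢 : Filtration ℕ mΩ) {u v : ℕ → Ω → ℝ}
    (hum : ∀ j, StronglyMeasurable[𝒢 (j + 1)] (u j)) (hu : ∀ j ω, u j ω ∈ Set.Icc (1 / 2 : ℝ) 1)
    (hvm : ∀ j, StronglyMeasurable[𝒢 j] (v j)) (hv : ∀ j ω, 1 / 2 ≤ v j ω)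
    (huv : ∀ j, μ[u j | 𝒢 j] =ᵐ[μ] v j) (k d : ℕ) :
    ∫ ω, ∏ j ∈ Finset.Ioc k (k + d), u j ω / v j ω ∂μ = 1 := by
  have hratio : ∀ j ω, |u j ω / v j ω| ≤ 2 := fun j ω => by
    have h1 := (hu j ω).1
    have h2 := (hu j ω).2
    have h3 := hv j ω
    rw [abs_of_nonneg (div_nonneg (by linarith) (by linarith)), div_le_iff₀ (by linarith)]
    linarith
  induction d with
  | zero => simp
  | succ d ih =>
    have hvpos : ∀ j ω, 0 < v j ω := fun j ω => lt_of_lt_of_le (by norm_num) (hv j ω)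
    -- Z is the product without the last numerator, hence known at the last conditioning time.
    -- Conditioning turns that numerator into v, which cancels the denominator.
    set Z : Ω → ℝ := fun ω =>
      (∏ j ∈ Finset.Ioc k (k + d), u j ω / v j ω) * (v (k + d + 1) ω)⁻¹ with hZ
    have hZm : StronglyMeasurable[𝒢 (k + d + 1)] Z := by
      refine StronglyMeasurable.mul ?_ (hvm _).measurable.inv.stronglyMeasurable
      refine Finset.stronglyMeasurable_fun_prod _ fun j hj => ?_
      have hj' := Finset.mem_Ioc.1 hj
      exact (((hum j).mono (𝒢.mono (by omega))).measurable.div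
        ((hvm j).mono (𝒢.mono (by omega))).measurable).stronglyMeasurable
    have hZb : ∀ ω, |Z ω| ≤ 2 ^ d * 2 := fun ω => by
      rw [hZ, abs_mul, Finset.abs_prod]
      refine mul_le_mul ?_ ?_ (abs_nonneg _) (by positivity)
      · refine (Finset.prod_le_prod (fun j _ => abs_nonneg _) fun j _ => hratio j ω).trans_eq ?_
        simp
      · rw [abs_of_pos (inv_pos.2 (hvpos _ ω)), inv_le_comm₀ (hvpos _ ω) two_pos]
        have := hv (k + d + 1) ω
        linarith
    have hint : Integrable (u (k + d + 1)) μ :=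
      Integrable.of_bound ((hum _).mono (𝒢.le _)).aestronglyMeasurable 1
        (ae_of_all _ fun ω => by
          rw [Real.norm_of_nonneg (le_trans (by norm_num) (hu _ ω).1)]
          exact (hu _ ω).2)
    have h1 := integral_mul_condExp_of_bound (𝒢.le _) hZm hint hZb
    rw [← add_assoc]
    calc ∫ ω, ∏ j ∈ Finset.Ioc k (k + d + 1), u j ω / v j ω ∂μ
        = ∫ ω, Z ω * u (k + d + 1) ω ∂μ := by
          refine integral_congr_ae (ae_of_all _ fun ω => ?_)
          simp only [hZ]
          rw [Finset.prod_Ioc_succ_top (by omega)]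
          ring
      _ = ∫ ω, Z ω * (μ[u (k + d + 1) | 𝒢 (k + d + 1)]) ω ∂μ := h1
      _ = ∫ ω, ∏ j ∈ Finset.Ioc k (k + d), u j ω / v j ω ∂μ := by
          refine integral_congr_ae ?_
          filter_upwards [huv (k + d + 1)] with ω hω
          rw [hω, hZ]
          simp only
          rw [mul_assoc, inv_mul_cancel₀ (hvpos _ ω).ne', mul_one]
      _ = 1 := ih

/-- Random contraction factors whose conditional expectations are bounded by `w` have products
whose square roots are controlled in mean by the products of `w`. -/
theorem integral_sqrt_prod_le (𝒢 : Filtration ℕ mΩ) {u w : ℕ → Ω → ℝ}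
    (hum : ∀ j, StronglyMeasurable[𝒢 (j + 1)] (u j)) (hu : ∀ j ω, u j ω ∈ Set.Icc (1 / 2 : ℝ) 1)
    (hwm : ∀ j, AEStronglyMeasurable (w j) μ) (hw1 : ∀ j, ∀ᵐ ω ∂μ, w j ω ≤ 1)
    (huw : ∀ j, μ[u j | 𝒢 j] ≤ᵐ[μ] w j) (k d : ℕ) :
    ∫ ω, √(∏ j ∈ Finset.Ioc k (k + d), u j ω) ∂μ ≤
      √(∫ ω, ∏ j ∈ Finset.Ioc k (k + d), w j ω ∂μ) := by
  have hint : ∀ j, Integrable (u j) μ := fun j =>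
    Integrable.of_bound ((hum j).mono (𝒢.le _)).aestronglyMeasurable 1
      (ae_of_all _ fun ω => by
        rw [Real.norm_of_nonneg (le_trans (by norm_num) (hu _ ω).1)]
        exact (hu _ ω).2)
  -- Truncation changes the conditional mean only on a null set and makes it bounded below at every
  -- point.
  set v : ℕ → Ω → ℝ := fun j ω => max ((μ[u j | 𝒢 j]) ω) (1 / 2) with hvdef
  have hvm : ∀ j, StronglyMeasurable[𝒢 j] (v j) := fun j =>
    (Measurable.max stronglyMeasurable_condExp.measurable measurable_const).stronglyMeasurable
  have hv : ∀ j ω, 1 / 2 ≤ v j ω := fun j ω => le_max_right _ _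
  have huv : ∀ j, μ[u j | 𝒢 j] =ᵐ[μ] v j := fun j => by
    have h1 : μ[fun _ => (1 / 2 : ℝ) | 𝒢 j] ≤ᵐ[μ] μ[u j | 𝒢 j] :=
      condExp_mono (integrable_const _) (hint j) (ae_of_all _ fun ω => (hu j ω).1)
    rw [condExp_const (𝒢.le j)] at h1
    filter_upwards [h1] with ω hω
    exact (max_eq_left hω).symm
  have hvw : ∀ j, v j ≤ᵐ[μ] w j := fun j => (huv j).symm.le.trans (huw j)
  have hvpos : ∀ j ω, 0 < v j ω := fun j ω => lt_of_lt_of_le (by norm_num) (hv j ω)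
  have hupos : ∀ j ω, 0 < u j ω := fun j ω => lt_of_lt_of_le (by norm_num) (hu j ω).1
  set s := Finset.Ioc k (k + d)
  have hall : ∀ᵐ ω ∂μ, ∀ j, v j ω ≤ w j ω ∧ w j ω ≤ 1 :=
    ae_all_iff.2 fun j => (hvw j).and (hw1 j)
  have hXm : AEStronglyMeasurable (fun ω => ∏ j ∈ s, u j ω / v j ω) μ :=
    Finset.aestronglyMeasurable_fun_prod _ fun j _ =>
      (((hum j).mono (𝒢.le _)).measurable.div
        ((hvm j).mono (𝒢.le _)).measurable).aestronglyMeasurable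
  have hX : Integrable (fun ω => ∏ j ∈ s, u j ω / v j ω) μ := by
    refine Integrable.of_bound hXm (∏ j ∈ s, 2) (ae_of_all _ fun ω => ?_)
    rw [Real.norm_eq_abs, Finset.abs_prod]
    refine Finset.prod_le_prod (fun j _ => abs_nonneg _) fun j _ => ?_
    rw [abs_of_pos (div_pos (hupos j ω) (hvpos j ω)), div_le_iff₀ (hvpos j ω)]
    have h2 := (hu j ω).2
    have h3 := hv j ω
    linarith
  have hV : Integrable (fun ω => ∏ j ∈ s, v j ω) μ := by
    refine Integrable.of_bound (Finset.aestronglyMeasurable_fun_prod _ fun j _ =>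
      ((hvm j).mono (𝒢.le _)).aestronglyMeasurable) 1 ?_
    filter_upwards [hall] with ω hω
    rw [Real.norm_of_nonneg (Finset.prod_nonneg fun j _ => (hvpos j ω).le)]
    exact Finset.prod_le_one (fun j _ => (hvpos j ω).le) fun j _ => (hω j).1.trans (hω j).2
  have hW : Integrable (fun ω => ∏ j ∈ s, w j ω) μ := by
    refine Integrable.of_bound (Finset.aestronglyMeasurable_fun_prod _ fun j _ => hwm j) 1 ?_
    filter_upwards [hall] with ω hω
    have hw0 : ∀ j, 0 ≤ w j ω := fun j => (hvpos j ω).le.trans (hω j).1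
    rw [Real.norm_of_nonneg (Finset.prod_nonneg fun j _ => hw0 j)]
    exact Finset.prod_le_one (fun j _ => hw0 j) fun j _ => (hω j).2
  have hVW : ∫ ω, ∏ j ∈ s, v j ω ∂μ ≤ ∫ ω, ∏ j ∈ s, w j ω ∂μ := by
    refine integral_mono_ae hV hW ?_
    filter_upwards [hall] with ω hω
    exact Finset.prod_le_prod (fun j _ => (hvpos j ω).le) fun j _ => (hω j).1
  refine le_trans ?_ (Real.sqrt_le_sqrt hVW)
  have hIpos : 0 < ∫ ω, ∏ j ∈ s, v j ω ∂μ := by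
    have h1 : ∫ _, (∏ j ∈ s, (1 / 2 : ℝ)) ∂μ ≤ ∫ ω, ∏ j ∈ s, v j ω ∂μ :=
      integral_mono (integrable_const _) hV fun ω =>
        Finset.prod_le_prod (fun j _ => by norm_num) fun j _ => hv j ω
    refine lt_of_lt_of_le ?_ h1
    simp only [integral_const, probReal_univ, one_smul]
    positivity
  set I := ∫ ω, ∏ j ∈ s, v j ω ∂μ with hI
  have hc : 0 < √I := Real.sqrt_pos.2 hIpos
  have hX1 : ∫ ω, ∏ j ∈ s, u j ω / v j ω ∂μ = 1 :=
    integral_prod_div_eq_one 𝒢 hum hu hvm hv huv k d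
  -- Cauchy-Schwarz in the form of the weighted inequality of arithmetic and geometric means; the
  -- weight √I balances the two integrals, 1 and I.
  have hpt : ∀ ω, √(∏ j ∈ s, u j ω) ≤
      √I / 2 * (∏ j ∈ s, u j ω / v j ω) + (√I)⁻¹ / 2 * ∏ j ∈ s, v j ω := by
    intro ω
    have hXn : 0 ≤ ∏ j ∈ s, u j ω / v j ω :=
      Finset.prod_nonneg fun j _ => (div_pos (hupos j ω) (hvpos j ω)).le
    have hYn : 0 ≤ ∏ j ∈ s, v j ω := Finset.prod_nonneg fun j _ => (hvpos j ω).le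
    have hXY : ∏ j ∈ s, u j ω = (∏ j ∈ s, u j ω / v j ω) * ∏ j ∈ s, v j ω := by
      rw [← Finset.prod_mul_distrib]
      exact Finset.prod_congr rfl fun j _ => (div_mul_cancel₀ _ (hvpos j ω).ne').symm
    rw [hXY]
    refine Real.sqrt_le_iff.2 ⟨by positivity, ?_⟩
    set X := ∏ j ∈ s, u j ω / v j ω
    set Y := ∏ j ∈ s, v j ω
    have hcc : √I * (√I)⁻¹ = 1 := mul_inv_cancel₀ hc.ne'
    have h2 : (√I / 2 * X + (√I)⁻¹ / 2 * Y) ^ 2 =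
        (√I / 2 * X - (√I)⁻¹ / 2 * Y) ^ 2 + (√I * (√I)⁻¹) * (X * Y) := by ring
    rw [h2, hcc, one_mul]
    exact le_add_of_nonneg_left (sq_nonneg _)
  have hUint : Integrable (fun ω => √(∏ j ∈ s, u j ω)) μ := by
    refine Integrable.of_bound ?_ 1 (ae_of_all _ fun ω => ?_)
    · exact ((Finset.stronglyMeasurable_fun_prod s fun j _ =>
        (hum j).mono (𝒢.le _)).measurable.sqrt).aestronglyMeasurable
    · rw [Real.norm_of_nonneg (Real.sqrt_nonneg _)]
      refine Real.sqrt_le_one.2 ?_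
      exact Finset.prod_le_one (fun j _ => (hupos j ω).le) fun j _ => (hu j ω).2
  calc ∫ ω, √(∏ j ∈ s, u j ω) ∂μ
      ≤ ∫ ω, (√I / 2 * (∏ j ∈ s, u j ω / v j ω) + (√I)⁻¹ / 2 * ∏ j ∈ s, v j ω) ∂μ :=
        integral_mono hUint ((hX.const_mul _).add (hV.const_mul _)) hpt
    _ = √I / 2 * 1 + (√I)⁻¹ / 2 * I := by
        rw [integral_add (hX.const_mul _) (hV.const_mul _), integral_const_mul,
          integral_const_mul, hX1]
    _ = √I := by
        have : (√I)⁻¹ * I = √I := by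
          rw [inv_mul_eq_div, Real.div_sqrt]
        linear_combination (1 / 2 : ℝ) * this

theorem integral_rpow_le_rpow_integral {f : Ω → ℝ} (hf : AEStronglyMeasurable f μ)
    (hf01 : ∀ᵐ ω ∂μ, f ω ∈ Set.Icc (0 : ℝ) 1) {κ : ℝ} (hκ0 : 0 ≤ κ) (hκ1 : κ ≤ 1) :
    ∫ ω, f ω ^ κ ∂μ ≤ (∫ ω, f ω ∂μ) ^ κ := by
  refine (Real.concaveOn_rpow hκ0 hκ1).le_map_integral
    (Real.continuous_rpow_const hκ0).continuousOn isClosed_Ici ?_ ?_ ?_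
  · filter_upwards [hf01] with ω hω using hω.1
  · refine Integrable.of_bound hf 1 ?_
    filter_upwards [hf01] with ω hω
    rw [Real.norm_of_nonneg hω.1]
    exact hω.2
  · refine Integrable.of_bound
      ((Real.continuous_rpow_const hκ0).comp_aestronglyMeasurable hf) 1 ?_
    filter_upwards [hf01] with ω hω
    rw [Function.comp_apply, Real.norm_of_nonneg (Real.rpow_nonneg hω.1 κ)]
    exact Real.rpow_le_one hω.1 hω.2 hκ0

/-- From log z ≥ 1 - 1/z at z = 1 - x ≥ b one gets -x ≤ b log(1 - x); then 1 + s ≤ exp s. -/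
theorem one_sub_mul_le_rpow {x b c : ℝ} (hx0 : 0 ≤ x) (hb : 0 < b) (hx : x ≤ 1 - b)
    (hc : 0 ≤ c) : 1 - c * x ≤ (1 - x) ^ (c * b) := by
  have h1 : 0 < 1 - x := by linarith
  have h2 := Real.one_sub_inv_le_log_of_pos h1
  rw [Real.rpow_def_of_pos h1]
  have h3 : -x ≤ b * Real.log (1 - x) := by
    have h4 : b * (1 - x)⁻¹ ≤ 1 := by
      rw [mul_inv_le_iff₀ h1]
      linarith
    have h5 : 1 - (1 - x)⁻¹ = -(x * (1 - x)⁻¹) := by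
      field_simp
      ring
    rw [h5] at h2
    nlinarith
  have h6 := Real.add_one_le_exp (Real.log (1 - x) * (c * b))
  nlinarith

/-- The product U lies in (0, 1], so U^q ≤ √U. Jensen for the concave power κ moves it outside the
integral of ∏a; the 2q in the exponent comes from the square root and the q-th root. -/
theorem eLpNorm_prod_le (𝒢 : Filtration ℕ mΩ) {u a : ℕ → Ω → ℝ}
    (hum : ∀ j, StronglyMeasurable[𝒢 (j + 1)] (u j)) (hu : ∀ j ω, u j ω ∈ Set.Icc (1 / 2 : ℝ) 1)
    (ham : ∀ j, AEMeasurable (a j) μ) (ha : ∀ j, ∀ᵐ ω ∂μ, a j ω ∈ Set.Ico (0 : ℝ) 1)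
    {κ : ℝ} (hκ0 : 0 < κ) (hκ1 : κ ≤ 1)
    (hua : ∀ j, μ[u j | 𝒢 j] ≤ᵐ[μ] fun ω => a j ω ^ κ) {q b : ℝ} (hq : 1 ≤ q) {k t : ℕ}
    (hkt : k ≤ t) (hb : ∫ ω, ∏ j ∈ Finset.Ioc k t, a j ω ∂μ ≤ b) :
    eLpNorm (fun ω => ∏ j ∈ Finset.Ioc k t, u j ω) (ENNReal.ofReal q) μ ≤
      ENNReal.ofReal (b ^ (κ / (2 * q))) := by
  obtain ⟨d, rfl⟩ := Nat.exists_eq_add_of_le hkt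
  set s := Finset.Ioc k (k + d) with hs
  have hq0 : 0 < q := by linarith
  have hupos : ∀ j ω, 0 < u j ω := fun j ω => lt_of_lt_of_le (by norm_num) (hu j ω).1
  have hall : ∀ᵐ ω ∂μ, ∀ j, a j ω ∈ Set.Ico (0 : ℝ) 1 := ae_all_iff.2 ha
  have hA0 : 0 ≤ ∫ ω, ∏ j ∈ s, a j ω ∂μ := by
    refine integral_nonneg_of_ae ?_
    filter_upwards [hall] with ω hω
    exact Finset.prod_nonneg fun j _ => (hω j).1
  have h1 : ∫ ω, √(∏ j ∈ s, u j ω) ∂μ ≤ √(b ^ κ) := by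
    refine (integral_sqrt_prod_le 𝒢 hum hu (fun j => ((ham j).pow_const κ).aestronglyMeasurable)
      (fun j => ?_) hua k d).trans (Real.sqrt_le_sqrt ?_)
    · filter_upwards [ha j] with ω hω
      exact Real.rpow_le_one hω.1 hω.2.le hκ0.le
    · calc ∫ ω, ∏ j ∈ s, a j ω ^ κ ∂μ = ∫ ω, (∏ j ∈ s, a j ω) ^ κ ∂μ := by
            refine integral_congr_ae ?_
            filter_upwards [hall] with ω hω
            exact Real.finsetProd_rpow _ _ (fun j _ => (hω j).1) κ
        _ ≤ (∫ ω, ∏ j ∈ s, a j ω ∂μ) ^ κ := by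
            refine integral_rpow_le_rpow_integral
              (Finset.aestronglyMeasurable_fun_prod _ fun j _ => (ham j).aestronglyMeasurable)
              ?_ hκ0.le hκ1
            filter_upwards [hall] with ω hω
            exact ⟨Finset.prod_nonneg fun j _ => (hω j).1,
              Finset.prod_le_one (fun j _ => (hω j).1) fun j _ => (hω j).2.le⟩
        _ ≤ b ^ κ := Real.rpow_le_rpow hA0 hb hκ0.le
  have hb0 : 0 ≤ b := hA0.trans hb
  have hmeas : StronglyMeasurable (fun ω => ∏ j ∈ s, u j ω) :=
    Finset.stronglyMeasurable_fun_prod s fun j _ => (hum j).mono (𝒢.le _)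
  have hU : ∀ ω, 0 < ∏ j ∈ s, u j ω ∧ ∏ j ∈ s, u j ω ≤ 1 := fun ω =>
    ⟨Finset.prod_pos fun j _ => hupos j ω,
      Finset.prod_le_one (fun j _ => (hupos j ω).le) fun j _ => (hu j ω).2⟩
  have hmem : MemLp (fun ω => ∏ j ∈ s, u j ω) (ENNReal.ofReal q) μ :=
    MemLp.of_bound hmeas.aestronglyMeasurable 1 (ae_of_all _ fun ω => by
      rw [Real.norm_of_nonneg (hU ω).1.le]
      exact (hU ω).2)
  rw [hmem.eLpNorm_eq_integral_rpow_norm (by simpa using hq0) ENNReal.ofReal_ne_top,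
    ENNReal.toReal_ofReal hq0.le]
  refine ENNReal.ofReal_le_ofReal ?_
  have h2 : ∫ ω, ‖∏ j ∈ s, u j ω‖ ^ q ∂μ ≤ √(b ^ κ) := by
    refine le_trans (integral_mono_of_nonneg (ae_of_all _ fun ω => by positivity) ?_
      (ae_of_all _ fun ω => ?_)) h1
    · refine Integrable.of_bound hmeas.measurable.sqrt.aestronglyMeasurable 1
        (ae_of_all _ fun ω => ?_)
      rw [Real.norm_of_nonneg (Real.sqrt_nonneg _)]
      exact Real.sqrt_le_one.2 (hU ω).2
    · simp only
      rw [Real.norm_of_nonneg (hU ω).1.le, Real.sqrt_eq_rpow]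
      exact Real.rpow_le_rpow_of_exponent_ge (hU ω).1 (hU ω).2 (by linarith)
  refine (Real.rpow_le_rpow (integral_nonneg fun ω => by positivity) h2
    (inv_nonneg.2 hq0.le)).trans_eq ?_
  rw [Real.sqrt_eq_rpow, ← Real.rpow_mul hb0, ← Real.rpow_mul hb0]
  congr 1
  field_simp

end Decoupling

/-! ### Measurability of the matrix constructions. -/

section Measurability

variable {Ω : Type*} [MeasurableSpace Ω] {ι : Type*} [Fintype ι]

theorem measurable_matrix_mul {S T : Ω → Matrix ι ι ℝ} (hS : ∀ a b, Measurable fun ω => S ω a b)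
    (hT : ∀ a b, Measurable fun ω => T ω a b) (a b : ι) :
    Measurable fun ω => (S ω * T ω) a b := by
  simp_rw [Matrix.mul_apply]
  exact Finset.measurable_fun_sum _ fun c _ => (hS a c).mul (hT c b)

theorem measurable_matrix_trace {S : Ω → Matrix ι ι ℝ}
    (hS : ∀ a b, Measurable fun ω => S ω a b) : Measurable fun ω => (S ω).trace :=
  Finset.measurable_fun_sum _ fun c _ => hS c c

variable [DecidableEq ι]

theorem measurable_matrix_det {S : Ω → Matrix ι ι ℝ} (hS : ∀ a b, Measurable fun ω => S ω a b) :
    Measurable fun ω => (S ω).det := by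
  simp_rw [Matrix.det_apply']
  exact Finset.measurable_fun_sum _ fun σ _ =>
    (Finset.measurable_fun_prod _ fun i _ => hS _ _).const_mul _

/-- Cramer's rule; no invertibility is required, as inversion of reals is measurable with 0⁻¹ = 0.
-/
theorem measurable_matrix_inv {S : Ω → Matrix ι ι ℝ} (hS : ∀ a b, Measurable fun ω => S ω a b)
    (a b : ι) : Measurable fun ω => (S ω)⁻¹ a b := by
  simp_rw [Matrix.inv_def, Matrix.smul_apply, Ring.inverse_eq_inv', smul_eq_mul,
    Matrix.adjugate_apply]
  refine (measurable_matrix_det hS).inv.mul (measurable_matrix_det fun i j => ?_)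
  simp_rw [Matrix.updateRow_apply]
  split_ifs
  · exact measurable_const
  · exact hS i j

variable {m n : ℕ}

theorem measurable_contractionCoeff {S : Ω → Matrix (Fin m) (Fin m) ℝ}
    (hS : ∀ a b, Measurable fun ω => S ω a b) (a b : Fin m) :
    Measurable fun ω => contractionCoeff (S ω) a b := by
  have h1 := measurable_matrix_inv hS
  have h2 := measurable_matrix_trace h1
  exact ((Finset.measurable_fun_sum _ fun c _ => (h1 c a).mul (h1 c b)).div
    (h2.mul (h2.const_add 1))).div_const 2

theorem measurable_contraction_const {S : Ω → Matrix (Fin m) (Fin m) ℝ}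
    (hS : ∀ a b, Measurable fun ω => S ω a b) :
    Measurable fun ω => 1 - 1 / ((m : ℝ) * (1 + (S ω)⁻¹.trace)) / 2 :=
  (((((measurable_matrix_trace (measurable_matrix_inv hS)).const_add 1).const_mul
    (m : ℝ)).const_div 1).div_const 2).const_sub 1

theorem measurable_contraction {S B : Ω → Matrix (Fin m) (Fin m) ℝ}
    (hS : ∀ a b, Measurable fun ω => S ω a b) (hB : ∀ a b, Measurable fun ω => B ω a b) :
    Measurable fun ω => contraction (S ω) (B ω) := by
  simp_rw [contraction_eq_sub_sum]
  exact (measurable_contraction_const hS).sub (Finset.measurable_fun_sum _ fun a _ =>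
    Finset.measurable_fun_sum _ fun b _ => (measurable_contractionCoeff hS a b).mul (hB a b))

theorem measurable_accum {β : ℝ} {B : ℕ → Ω → Matrix (Fin m) (Fin m) ℝ} (t : ℕ)
    (hB : ∀ s < t, ∀ a b, Measurable fun ω => B s ω a b) (a b : Fin m) :
    Measurable fun ω => accum β (fun s => B s ω) t a b := by
  induction t generalizing a b with
  | zero => exact measurable_const
  | succ t ih =>
    simp_rw [accum, Matrix.smul_apply, Matrix.add_apply, smul_eq_mul]
    exact ((ih (fun s hs => hB s (by omega)) a b).add (hB t (by omega) a b)).const_mul β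

theorem measurable_windowInfo {φ : ℕ → Fin n → Ω → EuclideanSpace ℝ (Fin m)} {h t : ℕ}
    (hφ : ∀ k ≤ (t + 1) * h, ∀ i, Measurable (φ k i)) (a b : Fin m) :
    Measurable fun ω => windowInfo φ h t ω a b := by
  simp_rw [windowInfo, Matrix.smul_apply, Matrix.sum_apply, Matrix.smul_apply,
    Matrix.vecMulVec_apply, smul_eq_mul]
  refine (Finset.measurable_fun_sum _ fun i _ =>
    Finset.measurable_fun_sum _ fun k hk => ?_).const_mul _
  have h1 := hφ k (Finset.mem_Icc.1 hk).2 i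
  have h2 : ∀ c, Measurable fun ω => (φ k i ω).ofLp c := fun c =>
    (EuclideanSpace.proj (𝕜 := ℝ) c).measurable.comp h1
  exact (((h1.norm.pow_const 2).const_add 1).const_div 1).mul ((h2 a).mul (h2 b))

theorem measurable_info (G : SensorNetwork n) (α : ℝ)
    {φ : ℕ → Fin n → Ω → EuclideanSpace ℝ (Fin m)}
    (hφ : ∀ k i, Measurable (φ k i)) (P₀ : Fin n → Matrix (Fin m) (Fin m) ℝ) (t : ℕ) (i : Fin n)
    (a b : Fin m) :
    Measurable fun ω => info G α (fun s i => (φ s i ω).ofLp) P₀ t i a b := by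
  induction t generalizing i a b with
  | zero => exact measurable_const
  | succ t ih =>
    simp_rw [info, Matrix.sum_apply, Matrix.smul_apply, Matrix.add_apply, Matrix.smul_apply,
      Matrix.vecMulVec_apply, smul_eq_mul]
    have h2 : ∀ j c, Measurable fun ω => (φ t j ω).ofLp c := fun j c =>
      (EuclideanSpace.proj (𝕜 := ℝ) c).measurable.comp (hφ t j)
    exact Finset.measurable_fun_sum _ fun j _ =>
      (((ih j a b).const_mul α).add ((h2 j a).mul (h2 j b))).const_mul _

theorem measurable_blockDiag_info (G : SensorNetwork n) (α : ℝ)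
    {φ : ℕ → Fin n → Ω → EuclideanSpace ℝ (Fin m)}
    (hφ : ∀ k i, Measurable (φ k i)) (P₀ : Fin n → Matrix (Fin m) (Fin m) ℝ) (t : ℕ)
    (u v : Fin n × Fin m) :
    Measurable fun ω => blockDiag (info G α (fun s i => (φ s i ω).ofLp) P₀ t) u v := by
  simp_rw [blockDiag_apply]
  split_ifs
  · exact measurable_info G α hφ P₀ t _ _ _
  · exact measurable_const

theorem measurable_errorMatrix (G : SensorNetwork n) {α : ℝ} (hα : 0 < α)
    {φ : ℕ → Fin n → Ω → EuclideanSpace ℝ (Fin m)}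
    (hφ : ∀ k i, Measurable (φ k i)) {P₀ : Fin n → Matrix (Fin m) (Fin m) ℝ}
    (hP₀ : ∀ i, (P₀ i).PosDef) (y : ℕ → Fin n → Ω → ℝ) (θ₀ : Fin n → Fin m → ℝ) (t : ℕ)
    (u v : Fin n × Fin m) :
    Measurable fun ω => errorMatrix G α (fun s i => (φ s i ω).ofLp) (fun s i => y s i ω)
      θ₀ P₀ t u v := by
  have h1 := measurable_blockDiag_info G α hφ P₀
  have h2 : ∀ s u v, Measurable fun ω =>
      (blockDiag (info G α (fun s i => (φ s i ω).ofLp) P₀ s))⁻¹ u v := fun s =>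
    measurable_matrix_inv (h1 s)
  have h3 := measurable_matrix_mul (measurable_matrix_mul (h2 (t + 1))
    (T := fun _ => G.weight ⊗ₖ (1 : Matrix (Fin m) (Fin m) ℝ)) fun _ _ => measurable_const)
    (measurable_matrix_inv (h2 t)) u v
  convert h3.const_mul α using 2 with ω
  rw [errorMatrix, blockDiag_ffls_P G _ hα hP₀, blockDiag_ffls_P G _ hα hP₀, Matrix.smul_apply,
    smul_eq_mul]

end Measurability

/-! ### Conditioning at window boundaries and moments of the inverse accumulation. -/

section WindowFiltration

variable {Ω : Type*} [mΩ : MeasurableSpace Ω]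

/-- The filtration sampled at the multiples of the window length. -/
def windowFiltration (ℱ : Filtration ℕ mΩ) (h : ℕ) : Filtration ℕ mΩ where
  seq j := ℱ (j * h)
  mono' _ _ hij := ℱ.mono (Nat.mul_le_mul_right h hij)
  le' _ := ℱ.le _

variable {μ : Measure Ω} [IsProbabilityMeasure μ] {n m : ℕ}
  {φ : ℕ → Fin n → Ω → EuclideanSpace ℝ (Fin m)} {h : ℕ} {ℱ : Filtration ℕ mΩ}

theorem measurable_window_of_adapted (hφ : ∀ i, StronglyAdapted ℱ fun t => φ t i) (t : ℕ)
    (a b : Fin m) :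
    Measurable[windowFiltration ℱ h (t + 1)] fun ω => windowInfo φ h t ω a b :=
  @measurable_windowInfo Ω (ℱ ((t + 1) * h)) m n φ h t
    (fun k hk i => ((hφ i k).mono (ℱ.mono hk)).measurable) a b

theorem measurable_accum_of_adapted (hφ : ∀ i, StronglyAdapted ℱ fun t => φ t i) (β : ℝ) (t : ℕ)
    (a b : Fin m) :
    Measurable[windowFiltration ℱ h t]
      fun ω => accum β (fun s => windowInfo φ h s ω) t a b :=
  @measurable_accum Ω (windowFiltration ℱ h t) m β _ t (fun s hs a b =>
    (measurable_window_of_adapted hφ s a b).mono ((windowFiltration ℱ h).mono hs) le_rfl) a b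

theorem integrable_windowInfo (hφ : ∀ i, StronglyAdapted ℱ fun t => φ t i) (t : ℕ)
    (a b : Fin m) : Integrable (fun ω => windowInfo φ h t ω a b) μ :=
  Integrable.of_bound ((measurable_window_of_adapted hφ t a b).mono
    ((windowFiltration ℱ h).le _) le_rfl).aestronglyMeasurable 1
    (ae_of_all _ fun ω => abs_windowInfo_le φ h t ω a b)

theorem condExp_contraction [NeZero m] (hφ : ∀ i, StronglyAdapted ℱ fun t => φ t i) {β : ℝ}
    (hβ : 0 < β) (t : ℕ) :
    μ[fun ω => contraction (accum β (fun s => windowInfo φ h s ω) t) (windowInfo φ h t ω) |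
        windowFiltration ℱ h t] =ᵐ[μ]
      fun ω => contraction (accum β (fun s => windowInfo φ h s ω) t)
        (Matrix.of fun a b => (μ[fun ω' => windowInfo φ h t ω' a b | ℱ (t * h)]) ω) := by
  set 𝒢 := windowFiltration ℱ h
  set S : Ω → Matrix (Fin m) (Fin m) ℝ := fun ω => accum β (fun s => windowInfo φ h s ω) t
  have hS : ∀ a b, Measurable[𝒢 t] fun ω => S ω a b := measurable_accum_of_adapted hφ β t
  have hSpd : ∀ ω, (S ω).PosDef := fun ω =>
    accum_posDef hβ (fun s => windowInfo_posSemidef φ h s ω) t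
  set c : Ω → ℝ := fun ω => 1 - 1 / ((m : ℝ) * (1 + (S ω)⁻¹.trace)) / 2
  have hcm : Measurable[𝒢 t] c := @measurable_contraction_const Ω (𝒢 t) m S hS
  have hci : Integrable c μ := by
    refine Integrable.of_bound (hcm.mono (𝒢.le t) le_rfl).aestronglyMeasurable 1
      (ae_of_all _ fun ω => ?_)
    have hy := trace_inv_pos (hSpd ω)
    have h1 := one_div_card_mul_le (m := m) hy
    have h2 : 1 / (1 + (S ω)⁻¹.trace) ≤ 1 := by
      rw [div_le_one (by positivity)]
      linarith
    have h3 : 0 ≤ 1 / ((m : ℝ) * (1 + (S ω)⁻¹.trace)) := by positivity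
    rw [Real.norm_eq_abs, abs_le]
    constructor <;> simp only [c] <;> linarith
  set f : Fin m × Fin m → Ω → ℝ := fun p ω => contractionCoeff (S ω) p.1 p.2
  have hfm : ∀ p, StronglyMeasurable[𝒢 t] (f p) := fun p =>
    (@measurable_contractionCoeff Ω (𝒢 t) m S hS p.1 p.2).stronglyMeasurable
  have hfb : ∀ p ω, ‖f p ω‖ ≤ 1 := fun p ω => abs_contractionCoeff_le (hSpd ω) p.1 p.2
  set B : Fin m × Fin m → Ω → ℝ := fun p ω => windowInfo φ h t ω p.1 p.2
  have hBi : ∀ p, Integrable (B p) μ := fun p => integrable_windowInfo hφ t p.1 p.2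
  have hfBi : ∀ p, Integrable (f p * B p) μ := fun p =>
    (hBi p).bdd_mul ((hfm p).mono (𝒢.le t)).aestronglyMeasurable (ae_of_all _ (hfb p))
  have heq : (fun ω => contraction (S ω) (windowInfo φ h t ω)) = c - ∑ p, f p * B p := by
    funext ω
    rw [contraction_eq_sub_sum, Pi.sub_apply, Finset.sum_apply, Fintype.sum_prod_type]
    rfl
  rw [heq]
  have h1 := condExp_sub (m := 𝒢 t) hci (integrable_finsetSum' Finset.univ fun p _ => hfBi p)
  have h2 := condExp_finsetSum (m := 𝒢 t) (s := Finset.univ) (fun p _ => hfBi p)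
  have h3 : ∀ᵐ ω ∂μ, ∀ p, (μ[f p * B p | 𝒢 t]) ω = f p ω * (μ[B p | 𝒢 t]) ω :=
    ae_all_iff.2 fun p => condExp_stronglyMeasurable_mul_of_bound (𝒢.le t) (hfm p) (hBi p) 1
      (ae_of_all _ (hfb p))
  filter_upwards [h1, h2, h3] with ω h1 h2 h3
  rw [h1, Pi.sub_apply, h2, condExp_of_stronglyMeasurable (𝒢.le t) hcm.stronglyMeasurable hci,
    contraction_eq_sub_sum, Finset.sum_apply, Fintype.sum_prod_type]
  simp_rw [h3]
  rfl

/-- The conditional mean is at most 1 - λ_t/(2m). A diagonal entry of the conditional information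
gives λ_t ≤ h/(1 + h), so `one_sub_mul_le_rpow` applies with b = 1/(1 + h). -/
theorem condExp_contraction_le [NeZero m] (hφ : ∀ i, StronglyAdapted ℱ fun t => φ t i) {β : ℝ}
    (hβ : 0 < β) (t : ℕ)
    (ha : ∀ᵐ ω ∂μ, 1 - excitation μ ℱ φ h t ω ∈ Set.Ico (0 : ℝ) 1) :
    μ[fun ω => contraction (accum β (fun s => windowInfo φ h s ω) t) (windowInfo φ h t ω) |
        windowFiltration ℱ h t] ≤ᵐ[μ]
      fun ω => (1 - excitation μ ℱ φ h t ω) ^ (1 / (2 * (m : ℝ)) * (1 / (1 + (h : ℝ)))) := by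
  have h0 : μ[fun ω' => windowInfo φ h t ω' 0 0 | ℱ (t * h)] ≤ᵐ[μ]
      μ[fun _ => (h : ℝ) / (1 + h) | ℱ (t * h)] := by
    refine condExp_mono (integrable_windowInfo hφ t 0 0) (integrable_const _)
      (ae_of_all _ fun ω => ?_)
    simpa using windowInfo_quadForm_le φ h t ω (Pi.single 0 1)
  rw [condExp_const (ℱ.le _)] at h0
  filter_upwards [condExp_contraction hφ hβ t, ha, h0] with ω h1 h2 h3
  rw [h1]
  set A : Matrix (Fin m) (Fin m) ℝ :=
    Matrix.of fun a b => (μ[fun ω' => windowInfo φ h t ω' a b | ℱ (t * h)]) ω with hA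
  have hherm : A.IsHermitian := by
    ext a b
    rw [Matrix.conjTranspose_apply, star_trivial, hA, Matrix.of_apply, Matrix.of_apply]
    simp_rw [windowInfo_symm φ h t _ a b]
  have hl : excitation μ ℱ φ h t ω = minEigenvalue A := rfl
  have hl0 : 0 < excitation μ ℱ φ h t ω := by linarith [h2.2]
  have hl1 : excitation μ ℱ φ h t ω ≤ 1 := by linarith [h2.1]
  have hle := minEigenvalue_mul_le hherm
  rw [← hl] at hle
  have h4 := hle (Pi.single 0 1)
  rw [single_quadForm, single_dotProduct, Pi.single_eq_same, mul_one, mul_one] at h4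
  have h5 : excitation μ ℱ φ h t ω ≤ 1 - 1 / (1 + (h : ℝ)) := by
    refine (h4.trans h3).trans_eq ?_
    field_simp
    ring
  refine (contraction_le_of_le_quadForm (accum_posDef hβ
    (fun s => windowInfo_posSemidef φ h s ω) t) hl0.le hl1 hle).trans ?_
  refine le_trans (le_of_eq ?_) (one_sub_mul_le_rpow hl0.le (by positivity) h5
    (c := 1 / (2 * (m : ℝ))) (by positivity))
  rw [one_div_mul_eq_div]

/-- The traces of the inverses of the accumulated information are bounded in `L_q`. -/
theorem exists_eLpNorm_trace_inv_accum_le [NeZero m] {lam : ℝ}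
    (hexc : CooperativeExcitation μ ℱ φ h lam) {β q : ℝ} (hβ : 0 < β) (hq : 1 ≤ q)
    (hlam : lam ^ (1 / (2 * (m : ℝ)) * (1 / (1 + (h : ℝ))) / (2 * q)) < β) :
    ∃ K : ℝ, ∀ t, eLpNorm (fun ω => (accum β (fun s => windowInfo φ h s ω) t)⁻¹.trace)
      (ENNReal.ofReal q) μ ≤ ENNReal.ofReal K := by
  obtain ⟨hφ, -, hlam0, hlam1, ham, ha, M, hM, hprod⟩ := hexc
  have hm : (1 : ℝ) ≤ m := by exact_mod_cast NeZero.one_le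
  set κ := 1 / (2 * (m : ℝ)) * (1 / (1 + (h : ℝ))) with hκ
  have hκ0 : 0 < κ := by positivity
  have hκ1 : κ ≤ 1 := by
    refine mul_le_one₀ ?_ (by positivity) ?_
    · rw [div_le_one (by positivity)]; linarith
    · rw [div_le_one (by positivity)]
      have := Nat.cast_nonneg (α := ℝ) h
      linarith
  set 𝒢 := windowFiltration ℱ h
  set u : ℕ → Ω → ℝ := fun j ω =>
    contraction (accum β (fun s => windowInfo φ h s ω) j) (windowInfo φ h j ω) with hu
  have hSpd : ∀ j ω, (accum β (fun s => windowInfo φ h s ω) j).PosDef := fun j ω =>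
    accum_posDef hβ (fun s => windowInfo_posSemidef φ h s ω) j
  have hum : ∀ j, StronglyMeasurable[𝒢 (j + 1)] (u j) := fun j =>
    (@measurable_contraction Ω (𝒢 (j + 1)) m _ _ (fun a b =>
      (measurable_accum_of_adapted hφ β j a b).mono (𝒢.mono (Nat.le_succ j)) le_rfl)
      (measurable_window_of_adapted hφ j)).stronglyMeasurable
  have hu01 : ∀ j ω, u j ω ∈ Set.Icc (1 / 2 : ℝ) 1 := fun j ω =>
    ⟨half_le_contraction (hSpd j ω) (windowInfo_quadForm_le_self φ h j ω),
      contraction_le_one (hSpd j ω) (windowInfo_posSemidef φ h j ω)⟩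
  have hq0 : 0 < q := by linarith
  set e := κ / (2 * q) with he
  have he0 : 0 < e := by positivity
  -- Ratio of the geometric series: growth β⁻¹ per window against the L_q decay of the contraction
  -- factors.
  set ρ := β⁻¹ * lam ^ e with hρ
  have hρ0 : 0 ≤ ρ := by positivity
  have hρ1 : ρ < 1 := by
    rw [hρ, inv_mul_lt_one₀ hβ]
    exact hlam
  set C := β⁻¹ * (m + 1) * M ^ e with hC
  have hC0 : 0 ≤ C := by positivity
  have hterm : ∀ s t : ℕ, s ≤ t →
      eLpNorm (fun ω => β⁻¹ * (m + 1) * (β⁻¹ ^ (t - s) * ∏ j ∈ Finset.Ioc s t, u j ω))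
        (ENNReal.ofReal q) μ ≤ ENNReal.ofReal (C * ρ ^ (t - s)) := by
    intro s t hst
    have h1 := eLpNorm_prod_le 𝒢 hum hu01 ham ha hκ0 hκ1
      (fun j => condExp_contraction_le hφ hβ j (ha j)) hq hst (hprod s t hst)
    have h2 : (fun ω => β⁻¹ * (m + 1) * (β⁻¹ ^ (t - s) * ∏ j ∈ Finset.Ioc s t, u j ω)) =
        (β⁻¹ * (m + 1) * β⁻¹ ^ (t - s)) • fun ω => ∏ j ∈ Finset.Ioc s t, u j ω := by
      funext ω
      simp only [Pi.smul_apply, smul_eq_mul]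
      ring
    rw [h2]
    refine eLpNorm_const_smul_le.trans ?_
    rw [Real.enorm_of_nonneg (by positivity)]
    refine (mul_le_mul_right h1 _).trans_eq ?_
    rw [← ENNReal.ofReal_mul (by positivity)]
    congr 1
    rw [← he, Real.mul_rpow hM.le (by positivity), ← Real.rpow_natCast lam,
      ← Real.rpow_mul hlam0.le, mul_comm (((t - s : ℕ) : ℝ)), Real.rpow_mul hlam0.le,
      Real.rpow_natCast, hC, hρ, mul_pow]
    ring
  have hsucc : ∀ t, eLpNorm (fun ω => (accum β (fun s => windowInfo φ h s ω) (t + 1))⁻¹.trace)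
      (ENNReal.ofReal q) μ ≤ ENNReal.ofReal (C * (1 - ρ)⁻¹) := by
    intro t
    have h1 : eLpNorm (fun ω => (accum β (fun s => windowInfo φ h s ω) (t + 1))⁻¹.trace)
        (ENNReal.ofReal q) μ ≤ eLpNorm (∑ s ∈ Finset.range (t + 1), fun ω =>
          β⁻¹ * (m + 1) * (β⁻¹ ^ (t - s) * ∏ j ∈ Finset.Ioc s t, u j ω))
        (ENNReal.ofReal q) μ := by
      refine eLpNorm_mono_real fun ω => ?_
      rw [Real.norm_of_nonneg (trace_inv_pos (hSpd _ ω)).le, Finset.sum_apply]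
      exact trace_inv_accum_le_sum hβ (fun s => windowInfo_posSemidef φ h s ω)
        (fun s => windowInfo_quadForm_le_self φ h s ω) t
    refine h1.trans ((eLpNorm_sum_le (fun s _ => ?_) (by simpa using hq)).trans ?_)
    · exact (((Finset.stronglyMeasurable_fun_prod _ fun j _ =>
        (hum j).mono (𝒢.le _)).const_mul _).const_mul _).aestronglyMeasurable
    · refine (Finset.sum_le_sum fun s hs =>
        hterm s t (Nat.lt_succ_iff.1 (Finset.mem_range.1 hs))).trans ?_
      rw [← ENNReal.ofReal_sum_of_nonneg fun s _ => by positivity, ← Finset.mul_sum]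
      refine ENNReal.ofReal_le_ofReal (mul_le_mul_of_nonneg_left ?_ hC0)
      rw [← tsum_geometric_of_lt_one hρ0 hρ1]
      have h2 := Finset.sum_range_reflect (fun s => ρ ^ s) (t + 1)
      simp only [add_tsub_cancel_right] at h2
      rw [h2]
      exact (summable_geometric_of_lt_one hρ0 hρ1).sum_le_tsum _ fun s _ => by positivity
  refine ⟨max (m : ℝ) (C * (1 - ρ)⁻¹), fun t => ?_⟩
  cases t with
  | zero =>
    have h1 : (fun ω => (accum β (fun s => windowInfo φ h s ω) 0)⁻¹.trace) = fun _ => (m : ℝ) := by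
      funext ω
      simp [accum]
    rw [h1, eLpNorm_const _ (by simpa using hq0) (NeZero.ne μ), measure_univ,
      ENNReal.one_rpow, mul_one, Real.enorm_of_nonneg (Nat.cast_nonneg m)]
    exact ENNReal.ofReal_le_ofReal (le_max_left _ _)
  | succ t => exact (hsucc t).trans (ENNReal.ofReal_le_ofReal (le_max_right _ _))

end WindowFiltration

/-! ### Moments of the total information and the arithmetic of the exponents. -/

section Stability

variable {Ω : Type*} [mΩ : MeasurableSpace Ω] {μ : Measure Ω} [IsProbabilityMeasure μ] {n m : ℕ}

/-- The L_q norm of ‖φ‖² is the square of an L_{2q} norm, hence at most V after summing over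
sensors. The affine map x ↦ αx + V then preserves the bound K₀ + V/(1 - α). -/
theorem exists_eLpNorm_sum_trace_info_le (G : SensorNetwork n) {α : ℝ} (hα : 0 < α) (hα1 : α < 1)
    {φ : ℕ → Fin n → Ω → EuclideanSpace ℝ (Fin m)} (hφm : ∀ k i, Measurable (φ k i))
    {P₀ : Fin n → Matrix (Fin m) (Fin m) ℝ} {q r : ℝ} (hq : 1 ≤ q) (hqr : 2 * q ≤ r)
    (hφ : ∀ i, (⨆ t, eLpNorm (φ t i) (ENNReal.ofReal r) μ) < ∞) :
    ∃ K : ℝ, ∀ t, eLpNorm (fun ω => ∑ i, (info G α (fun s i => (φ s i ω).ofLp) P₀ t i).trace)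
      (ENNReal.ofReal q) μ ≤ ENNReal.ofReal K := by
  have hq0 : 0 < q := by linarith
  set V : ℝ≥0∞ := ∑ i, (⨆ t, eLpNorm (φ t i) (ENNReal.ofReal r) μ) ^ (2 : ℝ) with hV
  have hVtop : V ≠ ∞ :=
    ENNReal.sum_ne_top.2 fun i _ => ENNReal.rpow_ne_top_of_nonneg (by norm_num) (hφ i).ne
  have hstep : ∀ t, eLpNorm (fun ω => ∑ j, (φ t j ω).ofLp ⬝ᵥ (φ t j ω).ofLp)
      (ENNReal.ofReal q) μ ≤ V := by
    intro t
    have h1 : (fun ω => ∑ j, (φ t j ω).ofLp ⬝ᵥ (φ t j ω).ofLp) =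
        ∑ j, fun ω => ‖φ t j ω‖ ^ (2 : ℝ) := by
      funext ω
      rw [Finset.sum_apply]
      refine Finset.sum_congr rfl fun j _ => ?_
      rw [Real.rpow_two]
      exact (norm_toLp_sq _).symm
    rw [h1]
    refine (eLpNorm_sum_le (fun j _ =>
      ((hφm t j).norm.pow_const (2 : ℝ)).aestronglyMeasurable) (by simpa using hq)).trans ?_
    refine Finset.sum_le_sum fun j _ => ?_
    rw [eLpNorm_norm_rpow _ two_pos, ← ENNReal.ofReal_mul hq0.le]
    refine ENNReal.rpow_le_rpow ?_ two_pos.le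
    refine (eLpNorm_le_eLpNorm_of_exponent_le (ENNReal.ofReal_le_ofReal (by linarith))
      (hφm t j).aestronglyMeasurable).trans ?_
    exact le_iSup (fun t => eLpNorm (φ t j) (ENNReal.ofReal r) μ) t
  set K₀ := |∑ i, ((P₀ i)⁻¹).trace| with hK₀
  have hV0 : 0 ≤ V.toReal := ENNReal.toReal_nonneg
  have hα1' : 0 < 1 - α := by linarith
  refine ⟨K₀ + V.toReal / (1 - α), fun t => ?_⟩
  induction t with
  | zero =>
    simp_rw [info]
    rw [eLpNorm_const _ (by simpa using hq0) (NeZero.ne μ), measure_univ, ENNReal.one_rpow,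
      mul_one, Real.enorm_eq_ofReal_abs]
    refine ENNReal.ofReal_le_ofReal (le_add_of_nonneg_right (by positivity))
  | succ t ih =>
    simp_rw [sum_trace_info_succ]
    have hm1 : AEStronglyMeasurable
        (fun ω => ∑ i, (info G α (fun s i => (φ s i ω).ofLp) P₀ t i).trace) μ :=
      (Finset.measurable_fun_sum _ fun i _ =>
        measurable_matrix_trace (measurable_info G α hφm P₀ t i)).aestronglyMeasurable
    have hm2 : AEStronglyMeasurable (fun ω => ∑ j, (φ t j ω).ofLp ⬝ᵥ (φ t j ω).ofLp) μ := by
      refine (Finset.measurable_fun_sum _ fun j _ => ?_).aestronglyMeasurable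
      refine Finset.measurable_fun_sum _ fun c _ => ?_
      have h2 : Measurable fun ω => (φ t j ω).ofLp c :=
        (EuclideanSpace.proj (𝕜 := ℝ) c).measurable.comp (hφm t j)
      exact h2.mul h2
    refine (eLpNorm_add_le (hm1.const_mul α) hm2 (by simpa using hq)).trans ?_
    have h3 : eLpNorm (fun ω => α * ∑ i, (info G α (fun s i => (φ s i ω).ofLp) P₀ t i).trace)
        (ENNReal.ofReal q) μ ≤ ENNReal.ofReal α * ENNReal.ofReal (K₀ + V.toReal / (1 - α)) := by
      refine (eLpNorm_const_smul_le (c := α)).trans ?_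
      rw [Real.enorm_of_nonneg hα.le]
      exact mul_le_mul_right ih _
    refine (add_le_add h3 (hstep t)).trans ?_
    rw [← ENNReal.ofReal_mul hα.le]
    nth_rewrite 2 [← ENNReal.ofReal_toReal hVtop]
    rw [← ENNReal.ofReal_add (by positivity) hV0]
    refine ENNReal.ofReal_le_ofReal ?_
    have h4 : V.toReal = (1 - α) * (V.toReal / (1 - α)) := by field_simp
    have h5 : 0 ≤ K₀ := abs_nonneg _
    nlinarith

/-- After raising to the power h, the assumed exponent is at most 1/(8pm(1 + h)), because a ≤ 1 and
1 + h ≤ 4(4h + D - 1); a base below 1 reverses the order. -/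
theorem rpow_lt_pow_of_lower_bound {lam α p a D : ℝ} {m h : ℕ} (hlam0 : 0 < lam)
    (hlam1 : lam < 1) (hp : 1 ≤ p) (hm : 0 < m) (hh : 0 < h) (hD : 0 ≤ D) (ha0 : 0 ≤ a)
    (ha1 : a ≤ 1)
    (hα : lam ^ (a ^ 2 / (32 * p * (m : ℝ) * (h : ℝ) * (4 * (h : ℝ) + D - 1))) < α) :
    lam ^ (1 / (2 * (m : ℝ)) * (1 / (1 + (h : ℝ))) / (2 * (2 * p))) < α ^ h := by
  have hm' : (1 : ℝ) ≤ m := by exact_mod_cast hm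
  have hh' : (1 : ℝ) ≤ h := by exact_mod_cast hh
  have hden : 0 < 4 * (h : ℝ) + D - 1 := by linarith
  have hp0 : 0 < p := by linarith
  refine lt_of_le_of_lt ?_ (pow_lt_pow_left₀ hα (by positivity) hh.ne')
  rw [← Real.rpow_natCast, ← Real.rpow_mul hlam0.le]
  refine Real.rpow_le_rpow_of_exponent_ge hlam0 hlam1.le ?_
  have e1 : a ^ 2 / (32 * p * (m : ℝ) * (h : ℝ) * (4 * (h : ℝ) + D - 1)) * h =
      a ^ 2 / (32 * p * m * (4 * (h : ℝ) + D - 1)) := by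
    field_simp
  have e2 : 1 / (2 * (m : ℝ)) * (1 / (1 + (h : ℝ))) / (2 * (2 * p)) =
      1 / (8 * p * m * (1 + h)) := by
    field_simp
    norm_num
  rw [e1, e2]
  refine div_le_div₀ zero_le_one (pow_le_one₀ ha0 ha1) (by positivity) ?_
  have h1 : 0 < p * m := by positivity
  have h2 : 1 + (h : ℝ) ≤ 4 * (4 * (h : ℝ) + D - 1) := by linarith
  nlinarith [mul_le_mul_of_nonneg_left h2 h1.le]

end Stability

end DiffusionFFLS

end

theorem theorem1 {Ω : Type*} [mΩ : MeasurableSpace Ω] (μ : Measure Ω) [IsProbabilityMeasure μ]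
    {n m : ℕ} (G : DiffusionFFLS.SensorNetwork n) (hG : G.graph.Connected)
    (ℱ : Filtration ℕ mΩ) (φ : ℕ → Fin n → Ω → EuclideanSpace ℝ (Fin m))
    (y : ℕ → Fin n → Ω → ℝ)
    (θ₀ : Fin n → Fin m → ℝ) (P₀ : Fin n → Matrix (Fin m) (Fin m) ℝ)
    (hP₀ : ∀ i, (P₀ i).PosDef)
    (h : ℕ) (lam : ℝ) (hexc : DiffusionFFLS.CooperativeExcitation μ ℱ φ h lam)
    (α p : ℝ) (hp : 1 ≤ p)
    (hφ : ∀ i, (⨆ t, eLpNorm (φ t i) (ENNReal.ofReal (6 * p)) μ) < ∞)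
    (hα_lower : lam ^ (G.aMin ^ 2 /
      (32 * p * (m : ℝ) * (h : ℝ) * (4 * (h : ℝ) + (G.diameter : ℝ) - 1))) < α)
    (hα_upper : α < 1) :
    DiffusionFFLS.LpExponentiallyStable μ p fun t ω =>
      DiffusionFFLS.errorMatrix G α (fun s i => (φ s i ω).ofLp) (fun s i => y s i ω) θ₀ P₀ t := by
  have hlam0 : 0 < lam := hexc.2.2.1
  have hlam1 : lam < 1 := hexc.2.2.2.1
  have hh : 0 < h := hexc.2.1
  have hα : 0 < α := (Real.rpow_pos_of_pos hlam0 _).trans hα_lower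
  have hp0 : 0 < p := by linarith
  have hm : m ≠ 0 := by
    rintro rfl
    -- Division by zero makes the exponent 0, and the bounds on α become 1 < α < 1. The same
    -- collapse excludes `aMin = 0` below.
    simp only [Nat.cast_zero, mul_zero, zero_mul, div_zero, Real.rpow_zero] at hα_lower
    exact absurd hα_lower hα_upper.not_gt
  have : NeZero m := ⟨hm⟩
  have : NeZero n := ⟨by
    rintro rfl
    exact hG.nonempty.elim fun i => i.elim0⟩
  have ha0 : 0 ≤ G.aMin := Real.iInf_nonneg fun ij => G.weight_pow_nonneg _ _ _
  have haMin : 0 < G.aMin := by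
    refine lt_of_le_of_ne ha0 fun h0 => ?_
    rw [← h0, zero_pow two_ne_zero, zero_div, Real.rpow_zero] at hα_lower
    exact absurd hα_lower hα_upper.not_gt
  have hφm : ∀ k i, Measurable (φ k i) := fun k i => ((hexc.1 i k).mono (ℱ.le k)).measurable
  obtain ⟨C, hC, hnorm⟩ :=
    DiffusionFFLS.exists_norm_inv_info_le G haMin hα hα_upper.le hP₀ φ hh
  obtain ⟨K₁, hK₁⟩ := DiffusionFFLS.exists_eLpNorm_trace_inv_accum_le hexc (β := α ^ h)
    (q := 2 * p) (by positivity) (by linarith)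
    (DiffusionFFLS.rpow_lt_pow_of_lower_bound hlam0 hlam1 hp (Nat.pos_of_ne_zero hm) hh
      (Nat.cast_nonneg _) ha0 G.aMin_le_one hα_lower)
  obtain ⟨K₂, hK₂⟩ := DiffusionFFLS.exists_eLpNorm_sum_trace_info_le (P₀ := P₀) G hα hα_upper hφm
    (q := 2 * p) (r := 6 * p) (by linarith) (by linarith) hφ
  -- The rate is α; the absolute values guard against negative K₁, K₂, and the added 1 keeps the
  -- constant positive.
  refine ⟨α, hα.le, hα_upper, fun t u v =>
    (DiffusionFFLS.measurable_errorMatrix G hα hφm hP₀ y θ₀ t u v).aemeasurable,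
    C * (|K₁| * |K₂|) + 1, by positivity, fun k t hkt => ?_⟩
  obtain ⟨d, rfl⟩ := Nat.exists_eq_add_of_le hkt
  rw [add_tsub_cancel_left]
  set Y : Ω → ℝ := fun ω => (DiffusionFFLS.accum (α ^ h)
    (fun s => DiffusionFFLS.windowInfo φ h s ω) ((k + d + 1 - G.diameter - 1) / h))⁻¹.trace with hY
  set R : Ω → ℝ := fun ω =>
    ∑ i, (DiffusionFFLS.info G α (fun s i => (φ s i ω).ofLp) P₀ (k + 1) i).trace with hR
  have hRm : Measurable R := Finset.measurable_fun_sum _ fun i _ =>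
    DiffusionFFLS.measurable_matrix_trace (DiffusionFFLS.measurable_info G α hφm P₀ (k + 1) i)
  have hYm : Measurable Y := DiffusionFFLS.measurable_matrix_trace
    (DiffusionFFLS.measurable_matrix_inv fun a b =>
      (DiffusionFFLS.measurable_accum_of_adapted hexc.1 (α ^ h) _ a b).mono
        ((DiffusionFFLS.windowFiltration ℱ h).le _) le_rfl)
  have hpt : ∀ ω, ‖DiffusionFFLS.orderedProd (fun s => DiffusionFFLS.errorMatrix G α
      (fun s i => (φ s i ω).ofLp) (fun s i => y s i ω) θ₀ P₀ s) k d‖ ≤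
      ((α ^ d * C) • (Y • R)) ω := fun ω => by
    refine (DiffusionFFLS.norm_orderedProd_errorMatrix_le G _ hα hP₀ _ θ₀ k d).trans ?_
    have h1 : 0 ≤ R ω := Finset.sum_nonneg fun i _ =>
      (DiffusionFFLS.info_posDef G _ hα hP₀ _ i).posSemidef.trace_nonneg
    change _ ≤ α ^ d * C * (Y ω * R ω)
    rw [mul_assoc, ← mul_assoc C]
    exact mul_le_mul_of_nonneg_left (mul_le_mul_of_nonneg_right (hnorm ω _) h1) (by positivity)
  have hholder : ENNReal.HolderTriple (ENNReal.ofReal (2 * p)) (ENNReal.ofReal (2 * p))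
      (ENNReal.ofReal p) := ⟨by
    rw [← ENNReal.ofReal_inv_of_pos (by positivity), ← ENNReal.ofReal_inv_of_pos hp0,
      ← ENNReal.ofReal_add (by positivity) (by positivity)]
    congr 1
    field_simp
    norm_num⟩
  refine (eLpNorm_mono_real hpt).trans (eLpNorm_const_smul_le.trans ?_)
  rw [Real.enorm_of_nonneg (by positivity)]
  calc ENNReal.ofReal (α ^ d * C) * eLpNorm (Y • R) (ENNReal.ofReal p) μ
      ≤ ENNReal.ofReal (α ^ d * C) * (eLpNorm Y (ENNReal.ofReal (2 * p)) μ *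
          eLpNorm R (ENNReal.ofReal (2 * p)) μ) := by
        gcongr
        exact eLpNorm_smul_le_mul_eLpNorm hRm.aestronglyMeasurable hYm.aestronglyMeasurable
    _ ≤ ENNReal.ofReal (α ^ d * C) * (ENNReal.ofReal |K₁| * ENNReal.ofReal |K₂|) := by
        gcongr
        · exact (hK₁ _).trans (ENNReal.ofReal_le_ofReal (le_abs_self _))
        · exact (hK₂ _).trans (ENNReal.ofReal_le_ofReal (le_abs_self _))
    _ = ENNReal.ofReal (C * (|K₁| * |K₂|) * α ^ d) := by
        rw [← ENNReal.ofReal_mul (abs_nonneg _), ← ENNReal.ofReal_mul (by positivity)]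
        congr 1
        ring
    _ ≤ _ := ENNReal.ofReal_le_ofReal
        (mul_le_mul_of_nonneg_right (by linarith) (by positivity))
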